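/- Let $\mathbb{F}_q$ be a finite field with $q$ elements, and for $n\in\mathbb{Z}$ put $[n]_q=\frac{q^n-1}{q-1}$. Let $\mathcal{R}_q$ be the ring of polynomials $f(x)\in\mathbb{Q}[x]$ such that $f([n]_q)\in\mathbb{Z}[q^{-1}]$ for all $n\in\mathbb{Z}$. Let $\Phi_q$ be the set of monic irreducible polynomials in $\mathbb{F}_q[t]$ different from $t$. A multipartition is a function $\boldsymbol\mu$ from $\Phi_q$ to the set of partitions with $\boldsymbol\mu(p)=\varnothing$ for all but finitely many $p$. An element $g\in GL_n(\mathbb{F}_q)$ has type $\boldsymbol\mu$ if, for all $p\in\Phi_q$ and $i\ge 1$, the number of parts of $\boldsymbol\mu(p)$ equal to $i$ is the multiplicity of $p(t)^i$ as an elementary divisor of the $\mathbb{F}_q[t]$-module $\mathbb{F}_q^n$ on which $t$ acts by $g$. The modified type of $g$ is obtained from its type $\boldsymbol\mu$ by subtracting $1$ from each part of $\boldsymbol\mu(t-1)$. For $n \ge 0$ and a multipartition $\boldsymbol\mu$, let $X_{\boldsymbol\mu,n}\in Z(\mathbb{Z}GL_n(\mathbb{F}_q))$ be the sum of all elements of $GL_n(\mathbb{F}_q)$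 of modified type $\boldsymbol\mu$. There is exactly one family of elements $r_{\boldsymbol\mu,\boldsymbol\nu}^{\boldsymbol\lambda}\in\mathcal{R}_q$, indexed by triples of multipartitions and such that for given $\boldsymbol\mu,\boldsymbol\nu$ only finitely many $r_{\boldsymbol\mu,\boldsymbol\nu}^{\boldsymbol\lambda}$ are nonzero, for which $$X_{\boldsymbol\mu,m}X_{\boldsymbol\nu,m}=\sum_{\boldsymbol\lambda}r_{\boldsymbol\mu,\boldsymbol\nu}^{\boldsymbol\lambda}([m]_q)\,X_{\boldsymbol\lambda,m}\quad\text{in } \mathbb{Z}[q^{-1}]GL_m(\mathbb{F}_q)$$ for all $m\ge 0$ and all multipartitions $\boldsymbol\mu,\boldsymbol\nu$. Let the general linear Farahat–Higman algebra $\mathrm{FH}_q^{GL}$ be the free $\mathcal{R}_q$-module with basis the symbols $K_{\boldsymbol\mu}$ ($\boldsymbol\mu$ a multipartition), with the $\mathcal{R}_q$-bilinear multiplication given by $K_{\boldsymbol\mu}K_{\boldsymbol\nu}=\sum_{\boldsymbol\lambda}r_{\boldsymbol\mu,\boldsymbol\nu}^{\boldsymbol\lambda}K_{\boldsymbol\lambda}$.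 Then $\mathrm{FH}_q^{GL}$ is an associative, commutative, unital $\mathcal{R}_q$-algebra, with identity element $K_{\varnothing}$ (where $\varnothing$ is the empty multipartition). Moreover, for each $n\ge 0$ there is exactly one unital ring homomorphism $\Theta_n:\mathrm{FH}_q^{GL}\to Z(\mathbb{Z}[q^{-1}]GL_n(\mathbb{F}_q))$ such that $\Theta_n(K_{\boldsymbol\mu})=X_{\boldsymbol\mu,n}$ for all $\boldsymbol\mu$ and $\Theta_n(f\,a)=f([n]_q)\,\Theta_n(a)$ for all $f\in\mathcal{R}_q$ and $a\in\mathrm{FH}_q^{GL}$. -/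

import Mathlib

open Polynomial DirectSum
open scoped MatrixGroups

namespace GLFH

section

variable (F : Type*) [Field F] [Fintype F]

/-- The order `q` of the finite field, as a rational number. -/
noncomputable def q : ℚ := (Fintype.card F : ℚ)

/-- The ring `ℤ[q, q⁻¹] = ℤ[q⁻¹]`, as a subring of `ℚ`. -/
noncomputable def ZInv : Subring ℚ := Subring.closure {(q F)⁻¹}

/-- The `q`-integer `[n]_q = (q ^ n - 1) / (q - 1)` for an arbitrary integer `n`
(here `q ≥ 2`, so the denominator does not vanish). -/
noncomputable def qInt (n : ℤ) : ℚ := (q F ^ n - 1) / (q F - 1)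

/-- The ring `R_q` of quantum integer-valued polynomials, `q` being the order of `F`: the
polynomials `f` over `ℚ` such that `f([n]_q) ∈ ℤ[q, q⁻¹]` for all integers `n`. -/
noncomputable def Rq : Subring ℚ[X] where
  carrier := {f | ∀ n : ℤ, f.eval (qInt F n) ∈ ZInv F}
  mul_mem' := fun ha hb n => by
    rw [eval_mul]; exact (ZInv F).mul_mem (ha n) (hb n)
  one_mem' := fun n => by rw [eval_one]; exact (ZInv F).one_mem
  add_mem' := fun ha hb n => by
    rw [eval_add]; exact (ZInv F).add_mem (ha n) (hb n)
  zero_mem' := fun n => by rw [eval_zero]; exact (ZInv F).zero_mem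
  neg_mem' := fun ha n => by
    rw [eval_neg]; exact (ZInv F).neg_mem (ha n)

/-- Evaluation of an element of `R_q` at `[n]_q`. -/
noncomputable def evalAt (n : ℤ) : Rq F →+* ZInv F :=
  ((evalRingHom (qInt F n)).comp (Rq F).subtype).codRestrict (ZInv F) (fun f => f.2 n)

end

section

variable (F : Type*) [Field F]

/-- `Φ_q`: the monic irreducible polynomials over `F` that are different from `t`. -/
def Phi : Type _ := {p : F[X] // p.Monic ∧ Irreducible p ∧ p ≠ X}

/-- A multipartition: a finitely supported function from `Φ_q` to partitions, a partition being
given by the multiset of its (positive) parts. -/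
abbrev Multipartition : Type _ := Phi F →₀ Multiset ℕ+

/-- The polynomial `t - 1`, as an element of `Φ_q`. -/
noncomputable def tSubOne : Phi F :=
  ⟨X - C 1, monic_X_sub_C 1, irreducible_X_sub_C 1, fun h => by
    have := congrArg (Polynomial.eval (0 : F)) h
    simp at this⟩

end

/-- Subtract `1` from each part of a partition (parts that become `0` disappear). -/
def decrement (s : Multiset ℕ+) : Multiset ℕ+ := (s.filter (1 < ·)).map (· - 1)

section

variable {F : Type*} [Field F]

open Classical in
/-- The multipartition obtained by subtracting `1` from each part of the partition at `t - 1`. -/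
noncomputable def modify (μ : Multipartition F) : Multipartition F :=
  μ.update (tSubOne F) (decrement (μ (tSubOne F)))

/-- `HasType g μ`: the matrix `g` has type `μ`, i.e. `m_i(μ(p))` is the multiplicity of `p ^ i` as
an elementary divisor of the `F[t]`-module `F ^ n` on which `t` acts by `g`. In other words, this
module is isomorphic to the direct sum, over all `p ∈ Φ_q` and `i ≥ 1`, of `m_i(μ(p))` copies of
`F[t] / (p ^ i)`. -/
def HasType {n : ℕ} (g : GL (Fin n) F) (μ : Multipartition F) : Prop :=
  Nonempty (Module.AEval' (Matrix.toLin' (g : Matrix (Fin n) (Fin n) F)) ≃ₗ[F[X]]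
    ⨁ pi : Phi F × ℕ+, (Fin ((μ pi.1).count pi.2) →
      F[X] ⧸ Ideal.span {(pi.1.1 : F[X]) ^ (pi.2 : ℕ)}))

/-- `g` has modified type `ν`. -/
def HasModifiedType {n : ℕ} (g : GL (Fin n) F) (ν : Multipartition F) : Prop :=
  ∃ μ : Multipartition F, HasType g μ ∧ modify μ = ν

variable [Fintype F]

open Classical in
/-- `X_{ν, n} ∈ ℤ GL_n(F)`: the sum of all elements of modified type `ν` in `GL_n(F)`. -/
noncomputable def classSum (n : ℕ) (ν : Multipartition F) : MonoidAlgebra ℤ (GL (Fin n) F) :=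
  ∑ g : GL (Fin n) F with HasModifiedType g ν, MonoidAlgebra.single g 1

variable (F) in
/-- The inclusion of `ℤ GL_n(F)` in `ℤ[q⁻¹] GL_n(F)`. -/
noncomputable def extendScalars (n : ℕ) :
    MonoidAlgebra ℤ (GL (Fin n) F) →+* MonoidAlgebra (ZInv F) (GL (Fin n) F) :=
  MonoidAlgebra.mapRingHom (GL (Fin n) F) (Int.castRingHom (ZInv F))

variable (F) in
/-- A family `r_{μ, ν}^λ ∈ R_q` which, for fixed `μ` and `ν`, is nonzero for finitely many `λ`;
`r_{μ, ν}^λ` is `r μ ν λ`. -/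
abbrev StructureConstants : Type _ := Multipartition F → Multipartition F → Multipartition F →₀ Rq F

/-- The family `r` interpolates the structure constants of the centres of the group algebras:
`X_{μ, m} X_{ν, m} = ∑_λ r_{μ, ν}^λ([m]_q) X_{λ, m}` for all `m ≥ 0` and all `μ`, `ν`. -/
def Interpolates (r : StructureConstants F) : Prop :=
  ∀ (m : ℕ) (μ ν : Multipartition F),
    extendScalars F m (classSum m μ * classSum m ν) =
      (r μ ν).sum fun l c => evalAt F m c • extendScalars F m (classSum m l)

/-- The free `R_q`-module on the multipartitions, to be equipped with the bilinear multiplication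
with structure constants `r`. For the interpolating family `r` this is the general linear
Farahat-Higman algebra. -/
def FH (_r : StructureConstants F) : Type _ := Multipartition F →₀ Rq F

namespace FH

variable (r : StructureConstants F)

noncomputable instance : AddCommGroup (FH r) :=
  inferInstanceAs (AddCommGroup (Multipartition F →₀ Rq F))

noncomputable instance : Module (Rq F) (FH r) :=
  inferInstanceAs (Module (Rq F) (Multipartition F →₀ Rq F))

/-- The symbols `K_μ`, which form a basis of the free `R_q`-module. -/
noncomputable def K : Module.Basis (Multipartition F) (Rq F) (FH r) :=
  ⟨LinearEquiv.refl (Rq F) (Multipartition F →₀ Rq F)⟩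

/-- The `R_q`-bilinear multiplication with `K_μ K_ν = ∑_λ r_{μ, ν}^λ K_λ`. -/
noncomputable def mulHom : FH r →ₗ[Rq F] FH r →ₗ[Rq F] FH r :=
  (K r).constr (Rq F) fun μ => (K r).constr (Rq F) fun ν =>
    (r μ ν).sum fun l c => c • K r l

noncomputable instance : NonUnitalNonAssocRing (FH r) where
  mul x y := mulHom r x y
  left_distrib x y z := map_add (mulHom r x) y z
  right_distrib x y z := LinearMap.map_add₂ (mulHom r) x y z
  zero_mul x := LinearMap.map_zero₂ (mulHom r) x
  mul_zero x := map_zero (mulHom r x)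

instance : IsScalarTower (Rq F) (FH r) (FH r) :=
  ⟨fun c x y => LinearMap.map_smul₂ (mulHom r) c x y⟩

instance : SMulCommClass (Rq F) (FH r) (FH r) :=
  ⟨fun c x y => (map_smul (mulHom r x) c y).symm⟩

end FH

end

end GLFH

/-! The coefficient of `g` in `X_μ X_ν` is the number of factorizations of `g` into elements of
modified types `μ` and `ν`. The theorem rests on showing that, as the size of the matrices grows,
this number is a polynomial in `q ^ n`.

The modified type of `g` is the type of its core, the restriction of `g` to the range of `g - 1`
(`TypeOf.core`, `hasModifiedType_iff`). Hence it is unchanged by `g ↦ g ⊕ 1`, and together with the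
dimension it determines the conjugacy class (`exists_equiv_of_core`). If `T - 1 = P Q`, the core of
`T` depends, up to isomorphism, only on `ker P`, `range Q` and `Q P` (`exists_core_equiv`).

For a stabilization `g ⊕ 1` on `V₀ × F ^ n`, let `c` be the inverse of the first factor. The
modified type `μ` fixes the rank of `c - 1`, so `c - 1` factors through a fixed space `E` in exactly
`|GL(E)|` ways. The components of such a factorization along `V₀` range over a finite set
independent of `n`. The components `x : E → F ^ n` and `y : F ^ n → E` matter only through `ker x`,
`range y` and `y x` (`exists_unit_of_invariants`), which take finitely many values. For each value
the number of pairs `(x, y)` is a polynomial in `q ^ n` (`card_ker_range_comp_mem_powPoly`). Summing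
and dividing by `|GL(E)|` gives `pairCount_stabilize`.

A polynomial in `q ^ n` with values in `ℤ[q⁻¹]` for all large `n` has such values for every integer
`n`, by induction with a `q`-difference operator (`eval_zpow_mem_ZInv`); so the polynomials lie in
`R_q`. Subadditivity of the rank of `g - 1` makes only finitely many of them nonzero. They are
unique because every modified type occurs in all large `GL_m` and the numbers `[m]_q` are distinct.

For the same reason the specialisations to the group algebras are jointly injective. They are
multiplicative with central values, so associativity, commutativity and the unit law are inherited
from the centres. -/

namespace GLFH

universe u

/-! ### Regrouping direct sums by isomorphism class of summand -/

section Fibres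

open Classical in
/-- A direct sum of modules `N (d j)` over a finite index type only depends on the sizes of the
fibres of `d`. -/
theorem nonempty_directSum_fibre_equiv {R J ι : Type*} [CommRing R] [Fintype J] (N : ι → Type*)
    [∀ i, AddCommGroup (N i)] [∀ i, Module R (N i)] (d : J → ι) (c : ι → ℕ)
    (hc : ∀ i, c i = Fintype.card {j // d j = i}) :
    Nonempty ((⨁ j, N (d j)) ≃ₗ[R] ⨁ i, (Fin (c i) → N i)) := by
  have σ : ∀ i, {j // d j = i} ≃ Fin (c i) := fun i => Fintype.equivFinOfCardEq (hc i).symm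
  let h : J ≃ Σ i, Fin (c i) :=
    (Equiv.sigmaFiberEquiv d).symm.trans (Equiv.sigmaCongrRight σ)
  have hh : ∀ k, d (h.symm k) = k.1 := fun k => ((σ k.1).symm k.2).2
  have e : ∀ k : Σ i, Fin (c i), Nonempty (N (d (h.symm k)) ≃ₗ[R] N k.1) := fun k => by
    rw [hh k]; exact ⟨LinearEquiv.refl R _⟩
  exact ⟨(DirectSum.lequivCongrLeft R h).trans <|
    (DFinsupp.mapRange.linearEquiv fun k => (e k).some).trans <|
    (DirectSum.sigmaLcurryEquiv (δ := fun i (_ : Fin (c i)) => N i) R).trans <|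
    DFinsupp.mapRange.linearEquiv fun i => DirectSum.linearEquivFunOnFintype R _ _⟩

end Fibres

/-! ### Dimension of `f • M` for torsion `F[t]`-modules -/

section Rank

variable {F : Type*} [Field F]

variable (F) in
/-- The dimension of `f • M`. -/
noncomputable def smulRank (M : Type*) [AddCommMonoid M] [Module F M] [Module F[X] M]
    [IsScalarTower F F[X] M] (f : F[X]) : ℕ :=
  Module.finrank F (LinearMap.range (Algebra.lsmul F F M f))

theorem smulRank_congr {M N : Type*} [AddCommMonoid M] [Module F M] [Module F[X] M]
    [IsScalarTower F F[X] M] [AddCommMonoid N] [Module F N] [Module F[X] N]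
    [IsScalarTower F F[X] N] (e : M ≃ₗ[F[X]] N) (f : F[X]) : smulRank F M f = smulRank F N f := by
  have : LinearMap.range (Algebra.lsmul F F N f) =
      (LinearMap.range (Algebra.lsmul F F M f)).map
        ((e.restrictScalars F : M ≃ₗ[F] N) : M →ₗ[F] N) := by
    ext x
    simp only [LinearMap.mem_range, Submodule.mem_map, Algebra.lsmul_coe]
    constructor
    · rintro ⟨y, rfl⟩
      exact ⟨f • e.symm y, ⟨e.symm y, rfl⟩, by simp⟩
    · rintro ⟨_, ⟨y, rfl⟩, rfl⟩
      exact ⟨e y, by simp⟩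
  unfold smulRank
  rw [this]
  exact (LinearEquiv.finrank_map_eq (e.restrictScalars F) _).symm

theorem smulRank_pi {J : Type*} [Fintype J] (M : J → Type*) [∀ j, AddCommGroup (M j)]
    [∀ j, Module F (M j)] [∀ j, Module F[X] (M j)] [∀ j, IsScalarTower F F[X] (M j)]
    [∀ j, Module.Finite F (M j)] (f : F[X]) :
    smulRank F (∀ j, M j) f = ∑ j, smulRank F (M j) f := by
  let g : (∀ j, LinearMap.range (Algebra.lsmul F F (M j) f)) →ₗ[F] ∀ j, M j :=
    LinearMap.pi fun j => (Submodule.subtype _).comp (LinearMap.proj j)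
  have hg : Function.Injective g := fun x y h => by
    funext j; exact Subtype.ext (congrFun h j)
  have hr : LinearMap.range (Algebra.lsmul F F (∀ j, M j) f) = LinearMap.range g := by
    ext x
    simp only [LinearMap.mem_range, Algebra.lsmul_coe]
    constructor
    · rintro ⟨y, rfl⟩
      exact ⟨fun j => ⟨f • y j, y j, rfl⟩, rfl⟩
    · rintro ⟨y, rfl⟩
      choose z hz using fun j => (y j).2
      exact ⟨z, funext hz⟩
  unfold smulRank
  rw [hr, LinearMap.finrank_range_of_inj hg, Module.finrank_pi_fintype]

/-- With `v` the multiplicity of `p` in `f`, the map `r ↦ f r` modulo `p ^ i` has kernel `(p ^ (i -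
v))`, so its image is `F[t] / (p ^ (i - v))`. Truncated subtraction covers the case where `f` acts
by zero. -/
theorem smulRank_quotient {p : F[X]} (hp : Irreducible p) (i : ℕ) {f : F[X]} (hf : f ≠ 0) :
    smulRank F (F[X] ⧸ Ideal.span {p ^ i}) f = p.natDegree * (i - multiplicity p f) := by
  have hfin : FiniteMultiplicity p f := FiniteMultiplicity.of_prime_left hp.prime hf
  obtain ⟨c, hc, hpc⟩ := hfin.exists_eq_pow_mul_and_not_dvd
  set v := multiplicity p f with hv
  let φ : F[X] →ₗ[F[X]] F[X] ⧸ Ideal.span {p ^ i} :=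
    (LinearMap.lsmul F[X] _ f).comp (Ideal.span {p ^ i}).mkQ
  have hker : LinearMap.ker φ = Ideal.span {p ^ (i - v)} := by
    ext r
    have : φ r = Ideal.Quotient.mk _ (f * r) := rfl
    rw [LinearMap.mem_ker, this, Ideal.Quotient.eq_zero_iff_mem, Ideal.mem_span_singleton,
      Ideal.mem_span_singleton, hc, mul_assoc]
    rcases le_total i v with h | h
    · simp only [Nat.sub_eq_zero_of_le h, pow_zero, one_dvd, iff_true]
      exact (pow_dvd_pow p h).trans (dvd_mul_right _ _)
    · obtain ⟨k, rfl⟩ := Nat.exists_eq_add_of_le h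
      rw [pow_add, mul_dvd_mul_iff_left (pow_ne_zero _ hp.ne_zero), Nat.add_sub_cancel_left]
      exact ⟨fun H => hp.prime.pow_dvd_of_dvd_mul_left _ hpc H, fun H => H.mul_left c⟩
  have hrange : LinearMap.range (Algebra.lsmul F F (F[X] ⧸ Ideal.span {p ^ i}) f) =
      (LinearMap.range φ).restrictScalars F := by
    ext x
    simp only [LinearMap.mem_range, Algebra.lsmul_coe, Submodule.restrictScalars_mem]
    constructor
    · rintro ⟨y, rfl⟩
      obtain ⟨z, rfl⟩ := Submodule.mkQ_surjective _ y
      exact ⟨z, rfl⟩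
    · rintro ⟨y, rfl⟩
      exact ⟨(Ideal.span {p ^ i}).mkQ y, rfl⟩
  unfold smulRank
  rw [hrange]
  have e : (F[X] ⧸ Ideal.span {p ^ (i - v)}) ≃ₗ[F[X]] LinearMap.range φ :=
    (Submodule.quotEquivOfEq _ _ hker.symm).trans φ.quotKerEquivRange
  rw [show Module.finrank F ((LinearMap.range φ).restrictScalars F) =
    Module.finrank F (LinearMap.range φ) from rfl,
    ← (e.restrictScalars F).finrank_eq, finrank_quotient_span_eq_natDegree, natDegree_pow, mul_comm]

end Rank

/-! ### Multipartitions as multisets of pairs `(p, i)` -/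

section Combinatorics

variable {F : Type*} [Field F]

open Classical in
/-- The multiset of pairs `(p, i)`, with `i` a part of `μ p`. -/
noncomputable def parts (μ : Multipartition F) : Multiset (Phi F × ℕ+) :=
  μ.sum fun p s => s.map (Prod.mk p)

open Classical in
theorem count_parts (μ : Multipartition F) (x : Phi F × ℕ+) :
    (parts μ).count x = (μ x.1).count x.2 := by
  obtain ⟨p, i⟩ := x
  have h : ∀ p' : Phi F, ((μ p').map (Prod.mk p')).count (p, i) =
      if p' = p then (μ p').count i else 0 := by
    intro p'
    split_ifs with h
    · subst h
      exact Multiset.count_map_eq_count' _ _ (Prod.mk_right_injective p') i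
    · refine Multiset.count_eq_zero_of_notMem fun hm => h ?_
      obtain ⟨j, -, hj⟩ := Multiset.mem_map.1 hm
      exact congrArg Prod.fst hj
  rw [parts, Finsupp.sum, ← Multiset.coe_countAddMonoidHom, map_sum]
  simp only [Multiset.coe_countAddMonoidHom, h]
  rw [Finset.sum_ite_eq']
  split_ifs with hp
  · rfl
  · rw [Finsupp.notMem_support_iff.1 hp]; simp

theorem parts_injective : Function.Injective (parts (F := F)) := by
  classical
  intro μ ν h
  ext p i
  have := congrArg (Multiset.count (p, i)) h
  rw [count_parts, count_parts] at this
  convert this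

theorem exists_parts_eq (s : Multiset (Phi F × ℕ+)) : ∃ μ : Multipartition F, parts μ = s := by
  classical
  refine ⟨(s.map fun x => Finsupp.single x.1 {x.2}).sum, ?_⟩
  have hadd : ∀ μ ν : Multipartition F, parts (μ + ν) = parts μ + parts ν := fun μ ν =>
    Finsupp.sum_add_index' (by simp) (by simp)
  induction s using Multiset.induction with
  | empty => simp [parts]
  | cons a s ih =>
    rw [Multiset.map_cons, Multiset.sum_cons, hadd, ih, parts, Finsupp.sum_single_index (by simp)]
    simp

/-- The dimension of `f • M` for a module `M` of type `μ`, if `f ≠ 0`. -/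
noncomputable def typeRank (μ : Multipartition F) (f : F[X]) : ℕ :=
  ((parts μ).map fun x => x.1.1.natDegree * ((x.2 : ℕ) - multiplicity x.1.1 f)).sum

end Combinatorics

/-! ### The standard module of a given type and its ranks -/

section TypeOf

variable {F : Type*} [Field F]

/-- The `F[t]`-module of type `μ`. -/
abbrev TypeModule (μ : Multipartition F) : Type _ :=
  ⨁ pi : Phi F × ℕ+, (Fin ((μ pi.1).count pi.2) →
      F[X] ⧸ Ideal.span {(pi.1.1 : F[X]) ^ (pi.2 : ℕ)})

instance (x : Phi F × ℕ+) : Module.Finite F (F[X] ⧸ Ideal.span {(x.1.1 : F[X]) ^ (x.2 : ℕ)}) := by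
  refine Module.finite_of_finrank_pos ?_
  rw [finrank_quotient_span_eq_natDegree, natDegree_pow]
  exact Nat.mul_pos x.2.pos x.1.2.2.1.natDegree_pos

theorem nonempty_equiv_typeModule {J : Type*} [Fintype J] (d : J → Phi F × ℕ+)
    {μ : Multipartition F} (h : parts μ = Finset.univ.val.map d) :
    Nonempty ((⨁ j, F[X] ⧸ Ideal.span {((d j).1.1 : F[X]) ^ ((d j).2 : ℕ)}) ≃ₗ[F[X]]
      TypeModule μ) := by
  classical
  refine nonempty_directSum_fibre_equiv
    (fun x : Phi F × ℕ+ => F[X] ⧸ Ideal.span {(x.1.1 : F[X]) ^ (x.2 : ℕ)}) d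
    (fun x => (μ x.1).count x.2) fun x => ?_
  have := count_parts μ x
  rw [h, Multiset.count_map] at this
  rw [Fintype.card_subtype, ← this]
  simp only [eq_comm (a := x)]
  rfl

theorem exists_equiv_typeModule {F : Type u} [Field F] (μ : Multipartition F) :
    ∃ (J : Type u) (_ : Fintype J) (d : J → Phi F × ℕ+), parts μ = Finset.univ.val.map d ∧
      Nonempty (TypeModule μ ≃ₗ[F[X]]
        ∀ j, F[X] ⧸ Ideal.span {((d j).1.1 : F[X]) ^ ((d j).2 : ℕ)}) := by
  classical
  obtain ⟨e⟩ := nonempty_equiv_typeModule (fun x : (parts μ).ToType => x.1)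
    (μ := μ) (Multiset.map_univ_coe _).symm
  exact ⟨(parts μ).ToType, inferInstance, fun x => x.1, (Multiset.map_univ_coe _).symm,
    ⟨e.symm.trans (DirectSum.linearEquivFunOnFintype _ _ _)⟩⟩

instance (μ : Multipartition F) : Module.Finite F (TypeModule μ) := by
  obtain ⟨J, _, d, -, ⟨e⟩⟩ := exists_equiv_typeModule μ
  exact Module.Finite.equiv (e.restrictScalars F).symm

theorem smulRank_typeModule (μ : Multipartition F) {f : F[X]} (hf : f ≠ 0) :
    smulRank F (TypeModule μ) f = typeRank μ f := by
  obtain ⟨J, _, d, h, ⟨e⟩⟩ := exists_equiv_typeModule μ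
  rw [smulRank_congr e, smulRank_pi, typeRank, h, Multiset.map_map]
  exact Finset.sum_congr rfl fun j _ => smulRank_quotient (d j).1.2.2.1 _ hf

end TypeOf

/-! ### Ranks determine multipartitions; effect of modification on ranks -/

section RankCombinatorics

variable {F : Type*} [Field F]

theorem mem_parts {μ : Multipartition F} {x : Phi F × ℕ+} : x ∈ parts μ ↔ x.2 ∈ μ x.1 := by
  classical
  rw [← Multiset.count_pos, count_parts, Multiset.count_pos]

theorem parts_single (p : Phi F) (s : Multiset ℕ+) :
    parts (Finsupp.single p s) = s.map (Prod.mk p) :=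
  Finsupp.sum_single_index (by simp)

theorem parts_add (μ ν : Multipartition F) : parts (μ + ν) = parts μ + parts ν := by
  classical
  exact Finsupp.sum_add_index' (by simp) (by simp)

theorem typeRank_add (μ ν : Multipartition F) (f : F[X]) :
    typeRank (μ + ν) f = typeRank μ f + typeRank ν f := by
  simp [typeRank, parts_add]

theorem multiplicity_eq_zero_of_ne {p p' : Phi F} (h : p ≠ p') (k : ℕ) :
    multiplicity p.1 (p'.1 ^ k) = 0 := by
  refine multiplicity_eq_zero.2 fun hd => h (Subtype.ext ?_)
  exact eq_of_monic_of_associated p.2.1 p'.2.1 <|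
    (p.2.2.1.dvd_irreducible_iff_associated p'.2.2.1).1 (p.2.2.1.prime.dvd_of_dvd_pow hd)

open Classical in
-- Passing from `p ^ k` to `p ^ (k + 1)` costs `deg p` for each part at `p` larger than `k` and
-- nothing elsewhere.
theorem typeRank_pow (μ : Multipartition F) (p : Phi F) (k : ℕ) :
    typeRank μ (p.1 ^ k) = typeRank μ (p.1 ^ (k + 1)) +
      p.1.natDegree * (parts μ).countP fun x => x.1 = p ∧ k < x.2 := by
  unfold typeRank
  induction parts μ using Multiset.induction with
  | empty => simp
  | cons x s ih =>
    simp only [Multiset.map_cons, Multiset.sum_cons, Multiset.countP_cons, ih]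
    by_cases hx : x.1 = p
    · have hm : ∀ n, multiplicity p.1 (p.1 ^ n) = n := fun n =>
        multiplicity_pow_self_of_prime p.2.2.1.prime n
      rw [hx, hm, hm]
      by_cases hk : k < x.2
      · rw [if_pos ⟨rfl, hk⟩, show (x.2 : ℕ) - k = x.2 - (k + 1) + 1 by omega]
        ring
      · rw [if_neg (fun h => hk h.2), show (x.2 : ℕ) - k = 0 by omega,
          show (x.2 : ℕ) - (k + 1) = 0 by omega]
        ring
    · rw [if_neg (fun h => hx h.1), multiplicity_eq_zero_of_ne hx, multiplicity_eq_zero_of_ne hx]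
      ring

open Classical in
theorem countP_parts (μ : Multipartition F) (p : Phi F) (i : ℕ+) :
    ((parts μ).countP fun x => x.1 = p ∧ (i : ℕ) - 1 < x.2) =
      ((parts μ).countP fun x => x.1 = p ∧ (i : ℕ) < x.2) + (parts μ).count (p, i) := by
  induction parts μ using Multiset.induction with
  | empty => simp
  | cons x s ih =>
    simp only [Multiset.countP_cons, Multiset.count_cons, ih, Prod.ext_iff, ← PNat.coe_inj]
    have := i.pos
    split_ifs <;> first | omega | (exfalso; grind)

/-- First differences of the ranks of `p ^ k` count the parts at `p` exceeding `k`; differences of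
these counts give the multiplicities. This supplies the uniqueness half of the structure theorem. -/
theorem eq_of_typeRank_eq {μ ν : Multipartition F}
    (h : ∀ f : F[X], f ≠ 0 → typeRank μ f = typeRank ν f) : μ = ν := by
  classical
  apply parts_injective
  have key : ∀ (p : Phi F) (k : ℕ), ((parts μ).countP fun x => x.1 = p ∧ k < x.2) =
      ((parts ν).countP fun x => x.1 = p ∧ k < x.2) := fun p k => by
    have h1 := typeRank_pow μ p k
    have h2 := typeRank_pow ν p k
    rw [h _ (pow_ne_zero _ p.2.2.1.ne_zero), h _ (pow_ne_zero _ p.2.2.1.ne_zero), h2] at h1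
    exact (Nat.eq_of_mul_eq_mul_left p.2.2.1.natDegree_pos (Nat.add_left_cancel h1)).symm
  ext ⟨p, i⟩
  have h1 := countP_parts μ p i
  have h2 := countP_parts ν p i
  rw [key, key] at h1
  omega

theorem eq_of_equiv_typeModule {μ ν : Multipartition F} (e : TypeModule μ ≃ₗ[F[X]] TypeModule ν) :
    μ = ν :=
  eq_of_typeRank_eq fun f hf => by
    rw [← smulRank_typeModule μ hf, ← smulRank_typeModule ν hf, smulRank_congr e]

theorem modify_eq (μ : Multipartition F) :
    modify μ = μ.erase (tSubOne F) + Finsupp.single (tSubOne F) (decrement (μ (tSubOne F))) := by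
  rw [modify, Finsupp.update_eq_erase_add_single]

theorem decrement_sum (s : Multiset ℕ+) (v : ℕ) :
    ((decrement s).map fun i : ℕ+ => (i : ℕ) - v).sum =
      (s.map fun i : ℕ+ => (i : ℕ) - (v + 1)).sum := by
  unfold decrement
  induction s using Multiset.induction with
  | empty => simp
  | cons i s ih =>
    by_cases hi : 1 < i
    · rw [Multiset.filter_cons_of_pos _ hi]
      simp only [Multiset.map_cons, Multiset.sum_cons, ih, PNat.sub_coe, if_pos hi, PNat.one_coe]
      omega
    · rw [Multiset.filter_cons_of_neg _ hi]
      simp only [Multiset.map_cons, Multiset.sum_cons, ih]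
      have : (i : ℕ) ≤ 1 := not_lt.1 hi
      omega

/-- A factor `t - 1` raises the multiplicity only at `t - 1`, where `i - (v + 1) = (i - 1) - v`.
This matches the fact that applying `f` to the range of `T - 1` gives the range of `f(T) (T - 1)`.
-/
theorem typeRank_modify (μ : Multipartition F) {f : F[X]} (hf : f ≠ 0) :
    typeRank (modify μ) f = typeRank μ (f * (tSubOne F).1) := by
  have ht := (tSubOne F).2.2.1
  have h1 : typeRank μ (f * (tSubOne F).1) = typeRank (μ.erase (tSubOne F)) (f * (tSubOne F).1) +
      typeRank (Finsupp.single (tSubOne F) (μ (tSubOne F))) (f * (tSubOne F).1) := by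
    rw [← typeRank_add, Finsupp.erase_add_single]
  have hfm : ∀ p : Phi F, FiniteMultiplicity p.1 (f * (tSubOne F).1) := fun p =>
    FiniteMultiplicity.of_prime_left p.2.2.1.prime (mul_ne_zero hf ht.ne_zero)
  rw [modify_eq, typeRank_add, h1]
  congr 1
  · unfold typeRank
    refine congrArg Multiset.sum (Multiset.map_congr rfl fun x hx => ?_)
    have hne : x.1 ≠ tSubOne F := by
      rintro h
      rw [mem_parts, h, Finsupp.erase_same] at hx
      exact Multiset.notMem_zero _ hx
    have := multiplicity_eq_zero_of_ne hne 1
    rw [pow_one] at this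
    rw [multiplicity_mul x.1.2.2.1.prime (hfm _), this, add_zero]
  · have : ((tSubOne F).1).natDegree = 1 := natDegree_X_sub_C 1
    simp only [typeRank, parts_single, Multiset.map_map, Function.comp_def, this, one_mul]
    rw [decrement_sum, multiplicity_mul ht.prime (hfm _)]
    simp only [multiplicity_self]

theorem eq_map_decrement_add_replicate (s : Multiset ℕ+) :
    s = (decrement s).map (· + 1) + Multiset.replicate (s.count 1) 1 := by
  unfold decrement
  induction s using Multiset.induction with
  | empty => simp
  | cons i s ih =>
    by_cases hi : 1 < i
    · rw [Multiset.filter_cons_of_pos _ hi, Multiset.count_cons_of_ne hi.ne]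
      simp only [Multiset.map_cons, Multiset.cons_add]
      rw [← ih, PNat.sub_add_of_lt hi]
    · obtain rfl : i = 1 := le_antisymm (not_lt.1 hi) (one_le)
      rw [Multiset.filter_cons_of_neg _ hi, Multiset.count_cons_self, Multiset.replicate_succ,
        Multiset.add_cons, ← ih]

/-- Modification forgets only the number of parts `1` at `t - 1`, and the total dimension `typeRank
μ 1` recovers it. -/
theorem eq_of_modify_eq {μ ν : Multipartition F} (h : modify μ = modify ν)
    (h1 : typeRank μ 1 = typeRank ν 1) : μ = ν := by
  classical
  have he : μ.erase (tSubOne F) = ν.erase (tSubOne F) := by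
    have := congrArg (Finsupp.erase (tSubOne F)) h
    rwa [modify, modify, Finsupp.erase_update_eq_erase, Finsupp.erase_update_eq_erase] at this
  have hd : decrement (μ (tSubOne F)) = decrement (ν (tSubOne F)) := by
    have := DFunLike.congr_fun h (tSubOne F)
    rwa [modify, modify, Finsupp.update_apply, Finsupp.update_apply, if_pos rfl, if_pos rfl]
      at this
  have h2 : (μ (tSubOne F)).count 1 = (ν (tSubOne F)).count 1 := by
    rw [← Finsupp.erase_add_single (tSubOne F) μ, ← Finsupp.erase_add_single (tSubOne F) ν,
      typeRank_add, typeRank_add, he, add_right_inj, eq_map_decrement_add_replicate (μ _),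
      eq_map_decrement_add_replicate (ν _), hd] at h1
    simp only [typeRank, parts_single, Multiset.map_map, Function.comp_def, Multiset.map_add,
      Multiset.sum_add, Multiset.map_replicate, Multiset.sum_replicate] at h1
    have hm : multiplicity (tSubOne F).1 1 = 0 :=
      multiplicity_eq_zero.2 fun hd => (tSubOne F).2.2.1.not_isUnit (isUnit_of_dvd_one hd)
    have hn : ((tSubOne F).1).natDegree = 1 := natDegree_X_sub_C 1
    rw [hm, hn, add_right_inj] at h1
    simpa using h1
  rw [← Finsupp.erase_add_single (tSubOne F) μ, ← Finsupp.erase_add_single (tSubOne F) ν, he,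
    eq_map_decrement_add_replicate (μ _), eq_map_decrement_add_replicate (ν _), hd, h2]

theorem exists_modify_eq (ν : Multipartition F) : ∃ μ, modify μ = ν := by
  classical
  refine ⟨ν.update (tSubOne F) ((ν (tSubOne F)).map (· + 1)), ?_⟩
  have : ∀ s : Multiset ℕ+, decrement (s.map (· + 1)) = s := fun s => by
    unfold decrement
    rw [Multiset.filter_eq_self.2]
    · simp [Multiset.map_map]
    · intro a ha
      obtain ⟨b, -, rfl⟩ := Multiset.mem_map.1 ha
      exact PNat.lt_add_left 1 b
  ext p i
  by_cases hp : p = tSubOne F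
  · subst hp; simp [modify, this]
  · simp [modify, Finsupp.update_apply, hp]

end RankCombinatorics

/-! ### Types of endomorphisms: existence, uniqueness, conjugacy -/

section Endomorphisms

variable {F : Type*} [Field F] {V V' : Type*} [AddCommGroup V] [Module F V]
  [AddCommGroup V'] [Module F V']

/-- The endomorphism `T` has type `μ`. -/
def TypeOf (T : Module.End F V) (μ : Multipartition F) : Prop :=
  Nonempty (Module.AEval' T ≃ₗ[F[X]] TypeModule μ)

theorem hasType_iff {n : ℕ} (g : GL (Fin n) F) (μ : Multipartition F) :
    HasType g μ ↔ TypeOf (Matrix.toLin' (g : Matrix (Fin n) (Fin n) F)) μ := Iff.rfl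

theorem TypeOf.unique {T : Module.End F V} {μ ν : Multipartition F} (h : TypeOf T μ)
    (h' : TypeOf T ν) : μ = ν := by
  obtain ⟨e⟩ := h
  obtain ⟨e'⟩ := h'
  exact eq_of_equiv_typeModule (e.symm.trans e')

theorem TypeOf.congr {T : Module.End F V} {T' : Module.End F V'} {μ : Multipartition F}
    (h : TypeOf T μ) (e : V ≃ₗ[F] V') (he : ∀ v, e (T v) = T' (e v)) : TypeOf T' μ := by
  obtain ⟨e'⟩ := h
  refine ⟨LinearEquiv.trans (LinearEquiv.ofAEval T' (e.symm.trans (Module.AEval'.of T)) ?_) e'⟩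
  intro m
  have : e.symm (T' m) = T (e.symm m) := by
    rw [LinearEquiv.symm_apply_eq, he, LinearEquiv.apply_symm_apply]
  simp [Module.AEval'.X_smul_of, this]

theorem TypeOf.exists_equiv {T : Module.End F V} {T' : Module.End F V'} {μ : Multipartition F}
    (h : TypeOf T μ) (h' : TypeOf T' μ) : ∃ e : V ≃ₗ[F] V', ∀ v, e (T v) = T' (e v) := by
  obtain ⟨e⟩ := h
  obtain ⟨e'⟩ := h'
  refine ⟨(Module.AEval'.of T).trans (((e.trans e'.symm).restrictScalars F).trans
    (Module.AEval'.of T').symm), fun v => ?_⟩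
  simp [← Module.AEval'.X_smul_of]

theorem smulRank_aeval (T : Module.End F V) (f : F[X]) :
    smulRank F (Module.AEval' T) f = Module.finrank F (LinearMap.range (aeval T f)) := by
  unfold smulRank
  rw [← LinearEquiv.finrank_map_eq (Module.AEval'.of T) (LinearMap.range (aeval T f))]
  suffices LinearMap.range (Algebra.lsmul F F (Module.AEval' T) f) =
      (LinearMap.range (aeval T f)).map (Module.AEval'.of T).toLinearMap by rw [this]
  ext x
  simp only [LinearMap.mem_range, Submodule.mem_map, Algebra.lsmul_coe]
  constructor
  · rintro ⟨y, rfl⟩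
    exact ⟨_, ⟨(Module.AEval'.of T).symm y, rfl⟩, rfl⟩
  · rintro ⟨_, ⟨y, rfl⟩, rfl⟩
    exact ⟨Module.AEval'.of T y, rfl⟩

theorem TypeOf.finrank_range {T : Module.End F V} {μ : Multipartition F} (h : TypeOf T μ)
    {f : F[X]} (hf : f ≠ 0) :
    Module.finrank F (LinearMap.range (aeval T f)) = typeRank μ f := by
  obtain ⟨e⟩ := h
  rw [← smulRank_aeval, smulRank_congr e, smulRank_typeModule μ hf]

theorem TypeOf.finrank {T : Module.End F V} {μ : Multipartition F} (h : TypeOf T μ) :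
    Module.finrank F V = typeRank μ 1 := by
  rw [← h.finrank_range one_ne_zero, map_one, Module.End.one_eq_id, LinearMap.range_id,
    finrank_top]

theorem typeRank_X (μ : Multipartition F) : typeRank μ X = typeRank μ 1 := by
  unfold typeRank
  refine congrArg Multiset.sum (Multiset.map_congr rfl fun x _ => ?_)
  have h1 : multiplicity x.1.1 1 = 0 :=
    multiplicity_eq_zero.2 fun hd => x.1.2.2.1.not_isUnit (isUnit_of_dvd_one hd)
  have h2 : multiplicity x.1.1 X = 0 := multiplicity_eq_zero.2 fun hd => x.1.2.2.2 <|
    eq_of_monic_of_associated x.1.2.1 monic_X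
      ((x.1.2.2.1.dvd_irreducible_iff_associated irreducible_X).1 hd)
  rw [h1, h2]

/-- Since `t` is excluded from `Φ_q`, it is prime to every elementary divisor and acts with full
rank. -/
theorem TypeOf.injective [Module.Finite F V] {T : Module.End F V} {μ : Multipartition F}
    (h : TypeOf T μ) : Function.Injective T := by
  rw [LinearMap.injective_iff_surjective, ← LinearMap.range_eq_top]
  apply Submodule.eq_top_of_finrank_eq
  have := h.finrank_range X_ne_zero
  rw [aeval_X] at this
  rw [this, typeRank_X, h.finrank]

open Classical in
theorem exists_typeOf [Module.Finite F V] {T : Module.End F V} (hT : Function.Injective T) :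
    ∃ μ, TypeOf T μ := by
  obtain ⟨ι, _, p, hp, e, ⟨E⟩⟩ := Module.equiv_directSum_of_isTorsion
    (Module.AEval.isTorsion_of_finiteDimensional F V T)
  let N : ι → Type _ := fun i => F[X] ⧸ Submodule.span F[X] {p i ^ e i}
  let E' : Module.AEval' T ≃ₗ[F[X]] ∀ i, N i :=
    E.trans (DirectSum.linearEquivFunOnFintype _ _ _)
  have hX : ∀ y : ∀ i, N i, (X : F[X]) • y = 0 → y = 0 := by
    intro y hy
    obtain ⟨m, rfl⟩ := E'.surjective y
    obtain ⟨v, rfl⟩ := (Module.AEval'.of T).surjective m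
    rw [← map_smul, Module.AEval'.X_smul_of, LinearEquiv.map_eq_zero_iff,
      LinearEquiv.map_eq_zero_iff] at hy
    rw [hT (hy.trans (map_zero T).symm), map_zero, map_zero]
  -- A summand `F[t] / (t ^ e)` with `e > 0` contains the nonzero class of `t ^ (e - 1)`, which `t`
  -- kills; this contradicts the injectivity of `T`.
  have hpX : ∀ i, e i ≠ 0 → normalize (p i) ≠ X := by
    intro i hi hpi
    have hspan : Submodule.span F[X] {p i ^ e i} = Ideal.span {X ^ e i} := by
      refine Ideal.span_singleton_eq_span_singleton.2 ?_
      rw [← hpi]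
      exact (normalize_associated (p i)).symm.pow_pow
    have h0 : (Submodule.Quotient.mk (X ^ (e i - 1)) : N i) = 0 := by
      have := hX (Pi.single i (Submodule.Quotient.mk (X ^ (e i - 1)))) (by
        rw [← Pi.single_smul, ← Submodule.Quotient.mk_smul, Pi.single_eq_zero_iff,
          Submodule.Quotient.mk_eq_zero, smul_eq_mul, ← pow_succ', Nat.sub_add_cancel
          (Nat.one_le_iff_ne_zero.2 hi), hspan]
        exact Ideal.mem_span_singleton_self _)
      rwa [Pi.single_eq_zero_iff] at this
    rw [Submodule.Quotient.mk_eq_zero, hspan, Ideal.mem_span_singleton,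
      pow_dvd_pow_iff X_ne_zero not_isUnit_X] at h0
    omega
  -- The structure theorem allows exponents `0` and non-monic primes: the former give zero summands
  -- and are dropped, the latter are normalized.
  let d : {i // e i ≠ 0} → Phi F × ℕ+ := fun j =>
    (⟨normalize (p j.1), monic_normalize (hp j.1).ne_zero,
      (normalize_associated (p j.1)).symm.irreducible (hp j.1), hpX j.1 j.2⟩,
      ⟨e j.1, Nat.pos_of_ne_zero j.2⟩)
  obtain ⟨μ, hμ⟩ := exists_parts_eq (Finset.univ.val.map d)
  obtain ⟨G⟩ := nonempty_equiv_typeModule d hμ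
  let r : (∀ i, N i) →ₗ[F[X]] ∀ j : {i // e i ≠ 0}, N j.1 :=
    LinearMap.pi fun j => LinearMap.proj j.1
  have hsub : ∀ i, e i = 0 → Subsingleton (N i) := fun i hi => by
    refine Submodule.Quotient.subsingleton_iff.2 ?_
    rw [hi, pow_zero]
    exact Ideal.span_singleton_one
  have hr : Function.Bijective r := by
    constructor
    · intro x y h
      funext i
      by_cases hi : e i = 0
      · exact (hsub i hi).elim _ _
      · exact congrFun h ⟨i, hi⟩
    · intro y
      refine ⟨fun i => if hi : e i ≠ 0 then y ⟨i, hi⟩ else 0, ?_⟩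
      funext j
      exact dif_pos j.2
  have q : ∀ j, N j.1 ≃ₗ[F[X]] F[X] ⧸ Ideal.span {((d j).1.1 : F[X]) ^ ((d j).2 : ℕ)} := fun j =>
    Submodule.quotEquivOfEq _ _ <| Ideal.span_singleton_eq_span_singleton.2
      (normalize_associated (p j)).symm.pow_pow
  exact ⟨μ, ⟨E'.trans <| (LinearEquiv.ofBijective r hr).trans <|
    (LinearEquiv.piCongrRight q).trans <|
    (DirectSum.linearEquivFunOnFintype _ _ _).symm.trans G⟩⟩

theorem exists_hasType (μ : Multipartition F) : ∃ g : GL (Fin (typeRank μ 1)) F, HasType g μ := by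
  have hn : Module.finrank F (TypeModule μ) = typeRank μ 1 := by
    rw [← smulRank_typeModule μ one_ne_zero, smulRank, map_one, Module.End.one_eq_id,
      LinearMap.range_id, finrank_top]
  let b : TypeModule μ ≃ₗ[F] (Fin (typeRank μ 1) → F) :=
    LinearEquiv.ofFinrankEq _ _ (by rw [hn, Module.finrank_fin_fun])
  let T : Module.End F (Fin (typeRank μ 1) → F) :=
    b.toLinearMap ∘ₗ Algebra.lsmul F F (TypeModule μ) (X : F[X]) ∘ₗ b.symm.toLinearMap
  have hT : TypeOf T μ := ⟨LinearEquiv.ofAEval T b.symm fun m => by simp [T]⟩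
  let g : GL (Fin (typeRank μ 1)) F := Matrix.GeneralLinearGroup.toLin.symm
    (LinearMap.GeneralLinearGroup.ofLinearEquiv (LinearEquiv.ofInjectiveEndo T hT.injective))
  have hg : Matrix.toLin' (g : Matrix (Fin (typeRank μ 1)) (Fin (typeRank μ 1)) F) = T := by
    have : Matrix.GeneralLinearGroup.toLin g = LinearMap.GeneralLinearGroup.ofLinearEquiv
        (LinearEquiv.ofInjectiveEndo T hT.injective) := MulEquiv.apply_symm_apply _ _
    exact congrArg Units.val this
  exact ⟨g, by rw [hasType_iff, hg]; exact hT⟩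

end Endomorphisms

/-! ### The core of an endomorphism and its modified type -/

section Core

variable {F : Type*} [Field F] {V V' : Type*} [AddCommGroup V] [Module F V]
  [AddCommGroup V'] [Module F V']

theorem mem_range_sub_one (T : Module.End F V) {v : V} (hv : v ∈ LinearMap.range (T - 1)) :
    T v ∈ LinearMap.range (T - 1) := by
  obtain ⟨w, rfl⟩ := hv
  exact ⟨T w, by simp⟩

/-- The restriction of `T` to the range of `T - 1`. -/
noncomputable def core (T : Module.End F V) : Module.End F (LinearMap.range (T - 1)) :=
  T.restrict fun _ => mem_range_sub_one T

@[simp]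
theorem core_apply (T : Module.End F V) (v : LinearMap.range (T - 1)) :
    (core T v : V) = T v := rfl

theorem aeval_core_apply (T : Module.End F V) (f : F[X]) (v : LinearMap.range (T - 1)) :
    (aeval (core T) f v : V) = aeval T f v := by
  induction f using Polynomial.induction_on generalizing v with
  | C a => simp [Module.algebraMap_end_apply]
  | add f g hf hg => simp [hf, hg]
  | monomial n a h => 
    rw [pow_succ, ← mul_assoc, map_mul (aeval (core T)) _ X, map_mul (aeval T) _ X, aeval_X, aeval_X,
      Module.End.mul_apply, Module.End.mul_apply, h, core_apply]

theorem core_injective {T : Module.End F V} (h : Function.Injective T) :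
    Function.Injective (core T) := fun _ _ hxy => Subtype.ext (h (congrArg Subtype.val hxy))

/-- The kernel of `T` lies in the range of `T - 1`: if `T v = 0` then `v = (T - 1) (-v)`. -/
theorem injective_of_core_injective {T : Module.End F V} (h : Function.Injective (core T)) :
    Function.Injective T := by
  rw [injective_iff_map_eq_zero]
  intro v hv
  have hm : v ∈ LinearMap.range (T - 1) := ⟨-v, by simp [hv]⟩
  have h0 : core T ⟨v, hm⟩ = 0 := Subtype.ext hv
  exact congrArg Subtype.val ((injective_iff_map_eq_zero _).1 h _ h0)

/-- The core is injective, so it has some type `ν`; `typeRank_modify` shows that `ν` and `modify μ`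
have the same ranks for every nonzero `f`. -/
theorem TypeOf.core [Module.Finite F V] {T : Module.End F V} {μ : Multipartition F}
    (h : TypeOf T μ) : TypeOf (core T) (modify μ) := by
  obtain ⟨ν, hν⟩ := exists_typeOf (core_injective h.injective)
  convert hν
  refine eq_of_typeRank_eq fun f hf => ?_
  rw [typeRank_modify μ hf, ← h.finrank_range (mul_ne_zero hf (tSubOne F).2.2.1.ne_zero),
    ← hν.finrank_range hf, ← Submodule.finrank_map_subtype_eq]
  have hX : aeval T (tSubOne F).1 = T - 1 := by simp [tSubOne]
  suffices LinearMap.range (aeval T (f * (tSubOne F).1)) =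
      (LinearMap.range (aeval (GLFH.core T) f)).map (Submodule.subtype _) by rw [this]
  ext v
  simp only [Submodule.mem_map, LinearMap.mem_range, map_mul, hX]
  constructor
  · rintro ⟨w, rfl⟩
    exact ⟨_, ⟨⟨(T - 1) w, w, rfl⟩, rfl⟩, aeval_core_apply _ _ _⟩
  · rintro ⟨_, ⟨⟨_, w, rfl⟩, rfl⟩, rfl⟩
    exact ⟨w, (aeval_core_apply T f ⟨(T - 1) w, w, rfl⟩).symm⟩

theorem TypeOf.modify_of_core [Module.Finite F V] {T : Module.End F V} {ν : Multipartition F}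
    (h : TypeOf (GLFH.core T) ν) : ∃ μ, TypeOf T μ ∧ modify μ = ν := by
  obtain ⟨μ, hμ⟩ := exists_typeOf (injective_of_core_injective h.injective)
  exact ⟨μ, hμ, hμ.core.unique h⟩

theorem hasModifiedType_iff {n : ℕ} (g : GL (Fin n) F) (ν : Multipartition F) :
    HasModifiedType g ν ↔
      TypeOf (core (Matrix.toLin' (g : Matrix (Fin n) (Fin n) F))) ν := by
  constructor
  · rintro ⟨μ, hμ, rfl⟩
    exact TypeOf.core hμ
  · exact TypeOf.modify_of_core

/-- Endomorphisms of spaces of equal dimension with the same modified type are conjugate. -/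
theorem exists_equiv_of_core [Module.Finite F V] [Module.Finite F V'] {T : Module.End F V}
    {T' : Module.End F V'} {ν : Multipartition F} (h : TypeOf (core T) ν) (h' : TypeOf (core T') ν)
    (hd : Module.finrank F V = Module.finrank F V') :
    ∃ e : V ≃ₗ[F] V', ∀ v, e (T v) = T' (e v) := by
  obtain ⟨μ, hμ, rfl⟩ := h.modify_of_core
  obtain ⟨μ', hμ', hm⟩ := h'.modify_of_core
  obtain rfl := eq_of_modify_eq hm (by rw [← hμ.finrank, ← hμ'.finrank, hd])
  exact hμ.exists_equiv hμ'

/-- Up to isomorphism, the core of `1 + P Q` only depends on `ker P`, `range Q` and `Q P`. -/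
theorem exists_core_equiv {W : Type*} [AddCommGroup W] [Module F W] {P : W →ₗ[F] V}
    {Q : V →ₗ[F] W} {P' : W →ₗ[F] V'} {Q' : V' →ₗ[F] W} (hP : LinearMap.ker P = LinearMap.ker P')
    (hQ : LinearMap.range Q = LinearMap.range Q') (hQP : Q ∘ₗ P = Q' ∘ₗ P')
    {T : Module.End F V} {T' : Module.End F V'} (hT : T - 1 = P ∘ₗ Q) (hT' : T' - 1 = P' ∘ₗ Q') :
    ∃ e : LinearMap.range (T - 1) ≃ₗ[F] LinearMap.range (T' - 1),
      ∀ v, e (core T v) = core T' (e v) := by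
  have hr : LinearMap.range (T - 1) = LinearMap.range (P ∘ₗ (LinearMap.range Q).subtype) := by
    rw [hT, LinearMap.range_comp, LinearMap.range_comp, Submodule.range_subtype]
  have hr' : LinearMap.range (T' - 1) = LinearMap.range (P' ∘ₗ (LinearMap.range Q).subtype) := by
    rw [hT', hQ, LinearMap.range_comp, LinearMap.range_comp, Submodule.range_subtype]
  have hk : LinearMap.ker (P ∘ₗ (LinearMap.range Q).subtype) =
      LinearMap.ker (P' ∘ₗ (LinearMap.range Q).subtype) := by
    rw [LinearMap.ker_comp, LinearMap.ker_comp, hP]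
  -- Both ranges are the quotient of `range Q` by its intersection with `ker P`; the class of `w`
  -- corresponds to `P w` and to `P' w`.
  let e : LinearMap.range (T - 1) ≃ₗ[F] LinearMap.range (T' - 1) :=
    (LinearEquiv.ofEq _ _ hr).trans <| (LinearMap.quotKerEquivRange _).symm.trans <|
    (Submodule.quotEquivOfEq _ _ hk).trans <| (LinearMap.quotKerEquivRange _).trans <|
    (LinearEquiv.ofEq _ _ hr').symm
  have he : ∀ w (hw : w ∈ LinearMap.range Q) (h : P w ∈ LinearMap.range (T - 1)),
      (e ⟨P w, h⟩ : V') = P' w := by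
    intro w hw h
    have : (LinearEquiv.ofEq _ _ hr) ⟨P w, h⟩ =
        (LinearMap.quotKerEquivRange (P ∘ₗ (LinearMap.range Q).subtype))
          (Submodule.Quotient.mk ⟨w, hw⟩) := rfl
    simp only [e, LinearEquiv.trans_apply, this, LinearEquiv.symm_apply_apply]
    rfl
  refine ⟨e, fun v => Subtype.ext ?_⟩
  obtain ⟨v, hv⟩ := v
  obtain ⟨u, rfl⟩ := id hv
  have h1 : (T - 1) u = P (Q u) := by rw [hT]; rfl
  -- In these coordinates `T` and `T'` both act by `w ↦ w + Q (P w)`.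
  have h2 : ∀ w, T (P w) = P (w + Q (P w)) := fun w => by
    have : (T - 1) (P w) = P (Q (P w)) := by rw [hT]; rfl
    rw [map_add, ← this]; simp
  have h3 : ∀ w, T' (P' w) = P' (w + Q (P w)) := fun w => by
    have : (T' - 1) (P' w) = P' (Q (P w)) := by
      rw [hT', show Q (P w) = Q' (P' w) from LinearMap.congr_fun hQP w]; rfl
    rw [map_add, ← this]; simp
  have hcore : core T ⟨(T - 1) u, hv⟩ = ⟨P (Q u + Q (P (Q u))), by
      rw [← h2, ← h1]; exact mem_range_sub_one T hv⟩ := Subtype.ext (by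
    rw [core_apply]; simp only [h1, h2])
  rw [hcore, he _ (add_mem ⟨u, rfl⟩ ⟨_, rfl⟩), core_apply]
  have : (⟨(T - 1) u, hv⟩ : LinearMap.range (T - 1)) = ⟨P (Q u), h1 ▸ hv⟩ := Subtype.ext h1
  rw [this, he _ ⟨u, rfl⟩, h3]

end Core

/-! ### Counting linear maps by polynomials in `q ^ n` -/

section Counting

variable (F : Type*) [Fintype F]

theorem one_lt_q [Field F] : 1 < q F := by
  unfold q; exact_mod_cast Fintype.one_lt_card

theorem q_ne_zero [Field F] : q F ≠ 0 := (zero_lt_one.trans (one_lt_q F)).ne'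

/-- The algebra of the functions of `n` that are polynomials in `q ^ n`. -/
noncomputable def powPoly : Subalgebra ℚ (ℕ → ℚ) := Algebra.adjoin ℚ {fun n => q F ^ n}

variable {F}

theorem exists_eval_of_mem_powPoly {f : ℕ → ℚ} (hf : f ∈ powPoly F) :
    ∃ P : ℚ[X], ∀ n, f n = P.eval (q F ^ n) := by
  rw [powPoly, Algebra.adjoin_singleton_eq_range_aeval] at hf
  obtain ⟨P, rfl⟩ := hf
  refine ⟨P, fun n => ?_⟩
  change Pi.evalAlgHom ℚ (fun _ : ℕ => ℚ) n (aeval _ P) = _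
  rw [← aeval_algHom_apply, ← coe_aeval_eq_eval]
  rfl

theorem const_mem_powPoly (c : ℚ) : (fun _ => c) ∈ powPoly F := (powPoly F).algebraMap_mem c

theorem pow_mem_powPoly (b : ℕ) : (fun n => q F ^ (n * b)) ∈ powPoly F := by
  have := pow_mem (Algebra.subset_adjoin (R := ℚ) (Set.mem_singleton fun n : ℕ => q F ^ n)) b
  rwa [show (fun n : ℕ => q F ^ n) ^ b = fun n => q F ^ (n * b) from
    funext fun n => (pow_mul _ _ _).symm] at this

theorem sum_fun_mem_powPoly {ι : Type*} (s : Finset ι) (f : ι → ℕ → ℚ)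
    (h : ∀ i ∈ s, f i ∈ powPoly F) : (fun n => ∑ i ∈ s, f i n) ∈ powPoly F := by
  convert sum_mem h using 1
  funext n
  simp

open Classical in
/-- Inversion over a finite partially ordered set. -/
theorem card_eq_mem_powPoly {L : Type*} [PartialOrder L] [Finite L] (X : ℕ → Type*)
    [∀ n, Finite (X n)] (k : ∀ n, X n → L)
    (h : ∀ A, (fun n => (Nat.card {x : X n // A ≤ k n x} : ℚ)) ∈ powPoly F) (A : L) :
    (fun n => (Nat.card {x : X n // k n x = A} : ℚ)) ∈ powPoly F := by
  have := Fintype.ofFinite L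
  have := fun n => Fintype.ofFinite (X n)
  induction A using WellFoundedGT.induction with
  | ind A ih =>
    have key : ∀ n, Nat.card {x : X n // A ≤ k n x} = Nat.card {x : X n // k n x = A} +
        ∑ A' with A < A', Nat.card {x : X n // k n x = A'} := by
      intro n
      simp only [Nat.card_eq_fintype_card, Fintype.card_subtype]
      rw [Finset.card_eq_sum_card_fiberwise (f := k n) (t := Finset.univ.filter (A ≤ ·))
        (fun x hx => by simpa using hx)]
      have hs : Finset.univ.filter (A ≤ ·) = insert A (Finset.univ.filter (A < ·)) := by
        ext A'; simp [le_iff_eq_or_lt, eq_comm]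
      have hf : ∀ A' : L, A ≤ A' → ({x ∈ ({x : X n | A ≤ k n x} : Finset (X n)) | k n x = A'}) =
          ({x : X n | k n x = A'} : Finset (X n)) := by
        intro A' hA'
        ext x
        simp only [Finset.mem_filter, Finset.mem_univ, true_and, and_iff_right_iff_imp]
        rintro rfl; exact hA'
      rw [hs, Finset.sum_insert (by simp), hf A le_rfl]
      congr 1
      exact Finset.sum_congr rfl fun A' hA' => by rw [hf A' (Finset.mem_filter.1 hA').2.le]
    have e : (fun n => (Nat.card {x : X n // k n x = A} : ℚ)) =
        (fun n => (Nat.card {x : X n // A ≤ k n x} : ℚ)) -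
          fun n => ∑ A' with A < A', (Nat.card {x : X n // k n x = A'} : ℚ) := by
      funext n
      rw [Pi.sub_apply, key n]
      push_cast
      ring
    rw [e]
    exact sub_mem (h A) (sum_fun_mem_powPoly _ _ fun A' hA' => ih A' (Finset.mem_filter.1 hA').2)

/-- Both `x` and `γ` descend to `E / A`, where `x` becomes injective; composing the descended `γ`
with a left inverse of the descended `x` gives `y`. -/
theorem exists_comp_eq {F V W E : Type*} [Field F] [AddCommGroup V] [Module F V]
    [AddCommGroup W] [Module F W] [AddCommGroup E] [Module F E] {A : Submodule F E}
    {x : E →ₗ[F] V} (hx : LinearMap.ker x = A)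
    {γ : E →ₗ[F] W} (hγ : A ≤ LinearMap.ker γ) :
    ∃ y : V →ₗ[F] W, y ∘ₗ x = γ ∧ LinearMap.range y ≤ LinearMap.range γ := by
  obtain ⟨l, hl⟩ := LinearMap.exists_leftInverse_of_injective (A.liftQ x hx.ge)
    (by rw [Submodule.ker_liftQ, hx, Submodule.mkQ_map_self])
  refine ⟨A.liftQ γ hγ ∘ₗ l, ?_, ?_⟩
  · ext v
    have : l (x v) = A.mkQ v := LinearMap.congr_fun hl (A.mkQ v)
    simp [this]
  · rw [← Submodule.range_liftQ A γ hγ]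
    exact LinearMap.range_comp_le_range _ _

section Homs

variable [Field F] {V W E : Type*} [AddCommGroup V] [Module F V] [Module.Finite F V]
  [AddCommGroup W] [Module F W] [Module.Finite F W]
  [AddCommGroup E] [Module F E] [Module.Finite F E]

instance : Finite (V →ₗ[F] W) := Module.finite_of_finite F

theorem finite_submodule : Finite (Submodule F E) :=
  have : Finite E := Module.finite_of_finite F
  inferInstance

theorem card_hom_ker_le (A : Submodule F V) :
    Nat.card {x : V →ₗ[F] W // A ≤ LinearMap.ker x} =
      Fintype.card F ^ ((Module.finrank F V - Module.finrank F A) * Module.finrank F W) := by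
  let e : {x : V →ₗ[F] W // A ≤ LinearMap.ker x} ≃ (V ⧸ A →ₗ[F] W) :=
    { toFun := fun x => A.liftQ x.1 x.2
      invFun := fun y => ⟨y ∘ₗ A.mkQ, fun a ha => by
        simp [(Submodule.Quotient.mk_eq_zero A).2 ha]⟩
      left_inv := fun x => Subtype.ext (A.liftQ_mkQ _ _)
      right_inv := fun y => by ext; rfl }
  rw [Nat.card_congr e, Module.natCard_eq_pow_finrank (K := F), Module.finrank_linearMap,
    Submodule.finrank_quotient, Nat.card_eq_fintype_card]

theorem card_ker_eq_mem_powPoly (A : Submodule F E) :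
    (fun n => (Nat.card {x : E →ₗ[F] (Fin n → F) // LinearMap.ker x = A} : ℚ)) ∈ powPoly F := by
  have := finite_submodule (F := F) (E := E)
  refine card_eq_mem_powPoly (fun n => E →ₗ[F] (Fin n → F)) (fun n x => LinearMap.ker x)
    (fun A => ?_) A
  convert pow_mem_powPoly (F := F) (Module.finrank F E - Module.finrank F A) using 1
  funext n
  rw [card_hom_ker_le, Module.finrank_fin_fun, mul_comm]
  simp [q]

/-- The solutions `y` are a coset of the maps `V → B` that vanish on `range x`. The count is written
as a quotient so that its dependence on `dim V` is visibly a power of `q ^ dim V`. -/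
theorem card_hom_comp_eq {A : Submodule F E} {x : E →ₗ[F] V} (hx : LinearMap.ker x = A)
    {γ : E →ₗ[F] W} (hγ : A ≤ LinearMap.ker γ) {B : Submodule F W} (hB : LinearMap.range γ ≤ B) :
    (Nat.card {y : V →ₗ[F] W // y ∘ₗ x = γ ∧ LinearMap.range y ≤ B} : ℚ) =
      q F ^ (Module.finrank F V * Module.finrank F B) *
      (q F ^ ((Module.finrank F E - Module.finrank F A) * Module.finrank F B))⁻¹ := by
  obtain ⟨y₀, hy₀, hr₀⟩ := exists_comp_eq hx hγ
  let e : {y : V →ₗ[F] B // LinearMap.range x ≤ LinearMap.ker y} ≃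
      {y : V →ₗ[F] W // y ∘ₗ x = γ ∧ LinearMap.range y ≤ B} :=
    { toFun := fun y => ⟨y₀ + B.subtype ∘ₗ y.1, by
        ext v
        have h1 : y.1 (x v) = 0 := y.2 ⟨v, rfl⟩
        have h2 : y₀ (x v) = γ v := LinearMap.congr_fun hy₀ v
        simp [h1, h2], by
        rintro _ ⟨v, rfl⟩
        exact add_mem (hB (hr₀ ⟨v, rfl⟩)) (y.1 v).2⟩
      invFun := fun y => ⟨(y.1 - y₀).codRestrict B fun v =>
        sub_mem (y.2.2 ⟨v, rfl⟩) (hB (hr₀ ⟨v, rfl⟩)), by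
        rintro _ ⟨v, rfl⟩
        have h1 : y.1 (x v) = γ v := LinearMap.congr_fun y.2.1 v
        have h2 : y₀ (x v) = γ v := LinearMap.congr_fun hy₀ v
        exact Subtype.ext (by simp [h1, h2])⟩
      left_inv := fun y => by ext; simp
      right_inv := fun y => by ext; simp }
  have hrank : Module.finrank F (LinearMap.range x) =
      Module.finrank F E - Module.finrank F A := by
    have := LinearMap.finrank_range_add_finrank_ker x
    rw [hx] at this
    omega
  have hle : Module.finrank F (LinearMap.range x) ≤ Module.finrank F V := Submodule.finrank_le _
  rw [← Nat.card_congr e, card_hom_ker_le, ← hrank]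
  obtain ⟨c, hc⟩ := Nat.exists_eq_add_of_le hle
  rw [hc, Nat.add_sub_cancel_left, add_mul, pow_add]
  have := pow_ne_zero (Module.finrank F (LinearMap.range x) * Module.finrank F B) (q_ne_zero F)
  push_cast
  rw [mul_comm (q F ^ _), mul_assoc, mul_inv_cancel₀ this, mul_one]
  rfl

theorem card_ker_range_comp_mem_powPoly (A B : Submodule F E) (γ : E →ₗ[F] E) :
    (fun n => (Nat.card {p : (E →ₗ[F] (Fin n → F)) × ((Fin n → F) →ₗ[F] E) //
      LinearMap.ker p.1 = A ∧ LinearMap.range p.2 = B ∧ p.2 ∘ₗ p.1 = γ} : ℚ)) ∈ powPoly F := by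
  have := finite_submodule (F := F) (E := E)
  have : Finite (Submodule F E)ᵒᵈ := this
  -- The dual order appears because the condition that is easy to count is the upper bound `range y
  -- ≤ B`.
  have := card_eq_mem_powPoly (F := F) (L := (Submodule F E)ᵒᵈ)
    (fun n => {p : (E →ₗ[F] (Fin n → F)) × ((Fin n → F) →ₗ[F] E) //
      LinearMap.ker p.1 = A ∧ p.2 ∘ₗ p.1 = γ})
    (fun n p => OrderDual.toDual (LinearMap.range p.1.2)) (fun B' => ?_) (OrderDual.toDual B)
  · convert this using 3 with n
    exact Nat.card_congr
      { toFun := fun p => ⟨⟨p.1, p.2.1, p.2.2.2⟩, p.2.2.1⟩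
        invFun := fun p => ⟨p.1.1, p.1.2.1, p.2, p.1.2.2⟩
        left_inv := fun _ => rfl
        right_inv := fun _ => rfl }
  · obtain ⟨B, rfl⟩ := OrderDual.toDual.surjective B'
    by_cases h : A ≤ LinearMap.ker γ ∧ LinearMap.range γ ≤ B
    · have := mul_mem (mul_mem (card_ker_eq_mem_powPoly (F := F) A)
        (pow_mem_powPoly (Module.finrank F B))) (const_mem_powPoly
        (q F ^ ((Module.finrank F E - Module.finrank F A) * Module.finrank F B))⁻¹)
      convert this using 1
      funext n
      let e : {p : {p : (E →ₗ[F] (Fin n → F)) × ((Fin n → F) →ₗ[F] E) //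
          LinearMap.ker p.1 = A ∧ p.2 ∘ₗ p.1 = γ} // LinearMap.range p.1.2 ≤ B} ≃
          Σ x : {x : E →ₗ[F] (Fin n → F) // LinearMap.ker x = A},
            {y : (Fin n → F) →ₗ[F] E // y ∘ₗ x.1 = γ ∧ LinearMap.range y ≤ B} :=
        { toFun := fun p => ⟨⟨p.1.1.1, p.1.2.1⟩, ⟨p.1.1.2, p.1.2.2, p.2⟩⟩
          invFun := fun s => ⟨⟨(s.1.1, s.2.1), s.1.2, s.2.2.1⟩, s.2.2.2⟩
          left_inv := fun _ => rfl
          right_inv := fun _ => rfl }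
      have := Fintype.ofFinite {x : E →ₗ[F] (Fin n → F) // LinearMap.ker x = A}
      refine (congrArg Nat.cast (Nat.card_congr e)).trans ?_
      rw [Nat.card_sigma]
      push_cast
      rw [Finset.sum_congr rfl fun x _ => card_hom_comp_eq x.2 h.1 h.2, Finset.sum_const,
        Finset.card_univ, ← Nat.card_eq_fintype_card, Module.finrank_fin_fun, nsmul_eq_mul,
        ← mul_assoc]
      rfl
    · convert const_mem_powPoly (F := F) 0 using 1
      funext n
      rw [Nat.cast_eq_zero, Nat.card_eq_zero]
      refine Or.inl ⟨fun ⟨⟨⟨x, y⟩, hx, hxy⟩, hy⟩ => h ⟨?_, ?_⟩⟩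
      · rw [← hxy, ← hx]; exact LinearMap.ker_le_ker_comp _ _
      · rw [← hxy]; exact (LinearMap.range_comp_le_range _ _).trans hy

open Classical in
-- The invariants `(s, ker x, range y, y x)` live in a finite set `I` that does not involve `n`. As
-- `hC` compares different dimensions, the set `D` of admissible values is also independent of `n`,
-- and the count is a fixed sum of polynomials.
theorem card_invariant_mem_powPoly {S : Type*} [Finite S]
    (C : ∀ n, S → (E →ₗ[F] (Fin n → F)) → ((Fin n → F) →ₗ[F] E) → Prop)
    (hC : ∀ n n' s x y x' y', LinearMap.ker x = LinearMap.ker x' →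
      LinearMap.range y = LinearMap.range y' → y ∘ₗ x = y' ∘ₗ x' → C n s x y → C n' s x' y') :
    (fun n => (Nat.card {p : S × (E →ₗ[F] (Fin n → F)) × ((Fin n → F) →ₗ[F] E) //
      C n p.1 p.2.1 p.2.2} : ℚ)) ∈ powPoly F := by
  have := finite_submodule (F := F) (E := E)
  let I := S × Submodule F E × Submodule F E × (E →ₗ[F] E)
  have : Finite I := inferInstanceAs (Finite (S × Submodule F E × Submodule F E × (E →ₗ[F] E)))
  have := Fintype.ofFinite I
  let N : I → ℕ → ℚ := fun i n => (Nat.card {p : (E →ₗ[F] (Fin n → F)) × ((Fin n → F) →ₗ[F] E) //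
      LinearMap.ker p.1 = i.2.1 ∧ LinearMap.range p.2 = i.2.2.1 ∧ p.2 ∘ₗ p.1 = i.2.2.2} : ℚ)
  let D : I → Prop := fun i => ∃ n x y, LinearMap.ker x = i.2.1 ∧ LinearMap.range y = i.2.2.1 ∧
    y ∘ₗ x = i.2.2.2 ∧ C n i.1 x y
  convert sum_fun_mem_powPoly (F := F) (Finset.univ.filter D) N
    (fun i _ => card_ker_range_comp_mem_powPoly _ _ _) using 1
  funext n
  let e : {p : S × (E →ₗ[F] (Fin n → F)) × ((Fin n → F) →ₗ[F] E) // C n p.1 p.2.1 p.2.2} ≃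
      Σ i : {i // i ∈ Finset.univ.filter D},
        {p : (E →ₗ[F] (Fin n → F)) × ((Fin n → F) →ₗ[F] E) //
          LinearMap.ker p.1 = i.1.2.1 ∧ LinearMap.range p.2 = i.1.2.2.1 ∧
            p.2 ∘ₗ p.1 = i.1.2.2.2} :=
    { toFun := fun p => ⟨⟨(p.1.1, LinearMap.ker p.1.2.1, LinearMap.range p.1.2.2,
          p.1.2.2 ∘ₗ p.1.2.1), Finset.mem_filter.2 ⟨Finset.mem_univ _, n, p.1.2.1, p.1.2.2,
          rfl, rfl, rfl, p.2⟩⟩, ⟨p.1.2, rfl, rfl, rfl⟩⟩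
      invFun := fun t => ⟨(t.1.1.1, t.2.1), by
        obtain ⟨⟨i, hi⟩, ⟨p, hp⟩⟩ := t
        obtain ⟨-, n', x, y, h1, h2, h3, h4⟩ := Finset.mem_filter.1 hi
        exact hC n' n _ x y _ _ (h1.trans hp.1.symm) (h2.trans hp.2.1.symm)
          (h3.trans hp.2.2.symm) h4⟩
      left_inv := fun _ => rfl
      right_inv := by
        rintro ⟨⟨⟨s, A, B, γ⟩, hi⟩, ⟨⟨x, y⟩, hx, hy, hxy⟩⟩
        dsimp at hx hy hxy
        subst hx hy hxy
        rfl }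
  rw [Nat.card_congr e, Nat.card_sigma, ← Finset.attach_eq_univ]
  push_cast
  exact Finset.sum_attach (Finset.univ.filter D) fun i => N i n

end Homs

end Counting

/-! ### Factoring `c - 1` through a space `E` -/

section Factorizations

variable {F : Type*} [Field F] {V V' E : Type*} [AddCommGroup V] [Module F V]
  [AddCommGroup V'] [Module F V'] [AddCommGroup E] [Module F E]

/-- A linear map of rank `dim E` has as many factorizations through `E` as there are
automorphisms of `E`. -/
theorem card_factorizations [Module.Finite F V] [Module.Finite F E] {M : Module.End F V}
    (hM : Module.finrank F (LinearMap.range M) = Module.finrank F E) :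
    Nat.card {p : (E →ₗ[F] V) × (V →ₗ[F] E) // p.1 ∘ₗ p.2 = M} = Nat.card (E ≃ₗ[F] E) := by
  let e₀ : E ≃ₗ[F] LinearMap.range M := LinearEquiv.ofFinrankEq _ _ hM.symm
  let φ : (E ≃ₗ[F] E) → {p : (E →ₗ[F] V) × (V →ₗ[F] E) // p.1 ∘ₗ p.2 = M} := fun e =>
    ⟨((LinearMap.range M).subtype ∘ₗ (e.trans e₀).toLinearMap,
      (e.trans e₀).symm.toLinearMap ∘ₗ M.rangeRestrict), by ext v; simp⟩
  refine (Nat.card_eq_of_bijective φ ⟨fun e e' h => ?_, fun p => ?_⟩).symm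
  · have h1 := congrArg (fun p => p.1.1) h
    ext v
    have h2 := LinearMap.congr_fun h1 v
    exact e₀.injective (Subtype.ext h2)
  · obtain ⟨⟨x, y⟩, hxy⟩ := p
    dsimp at hxy
    have hle : LinearMap.range M ≤ LinearMap.range x := by
      rw [← hxy]; exact LinearMap.range_comp_le_range _ _
    have hdim := LinearMap.finrank_range_add_finrank_ker x
    have hr : LinearMap.range M = LinearMap.range x :=
      Submodule.eq_of_le_of_finrank_le hle (by omega)
    have hk : LinearMap.ker x = ⊥ := by
      rw [← Submodule.finrank_eq_zero (R := F)]
      rw [← hr] at hdim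
      omega
    have hinj := LinearMap.ker_eq_bot.1 hk
    let e : E ≃ₗ[F] LinearMap.range M :=
      (LinearEquiv.ofInjective x hinj).trans (LinearEquiv.ofEq _ _ hr.symm)
    have he : ∀ v, (e v : V) = x v := fun v => rfl
    refine ⟨e.trans e₀.symm, Subtype.ext (Prod.ext ?_ ?_)⟩
    · ext v
      simp [φ, he]
    · ext v
      apply hinj
      rw [← he]
      simpa [φ] using (LinearMap.congr_fun hxy v).symm

/-- If `w + y (x w) = 0`, then `x w` is killed by `1 + x y`, hence is zero, and so is `w`. -/
theorem injective_of_injective_swap {x : E →ₗ[F] V} {y : V →ₗ[F] E}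
    (h : Function.Injective (1 + x ∘ₗ y : Module.End F V)) :
    Function.Injective (1 + y ∘ₗ x : Module.End F E) := by
  rw [injective_iff_map_eq_zero] at h ⊢
  intro w hw
  have h1 : w + y (x w) = 0 := hw
  have h2 : x w = 0 := h (x w) (by simpa using congrArg x h1)
  simpa [h2] using h1

theorem units_injective (c : (Module.End F V)ˣ) : Function.Injective (c : Module.End F V) :=
  ((Module.End.isUnit_iff _).1 c.isUnit).1

theorem inv_sub_one_eq {x : E →ₗ[F] V} {y : V →ₗ[F] E} {c : (Module.End F V)ˣ}
    (hc : (c : Module.End F V) = 1 + x ∘ₗ y) :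
    (c⁻¹ : (Module.End F V)ˣ).1 - 1 = (-((c⁻¹ : (Module.End F V)ˣ).1 ∘ₗ x)) ∘ₗ y := by
  have h1 : (c⁻¹ : (Module.End F V)ˣ).1 * (c : Module.End F V) = 1 := c.inv_mul
  rw [hc, mul_add, mul_one] at h1
  rw [LinearMap.neg_comp, LinearMap.comp_assoc, ← h1]
  simp [Module.End.mul_eq_comp]

theorem ker_neg_units_comp (x : E →ₗ[F] V) (c : (Module.End F V)ˣ) :
    LinearMap.ker (-(c.1 ∘ₗ x)) = LinearMap.ker x := by
  ext w
  rw [LinearMap.mem_ker, LinearMap.mem_ker, LinearMap.neg_apply, neg_eq_zero,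
    LinearMap.comp_apply]
  exact map_eq_zero_iff _ (units_injective c)

/-- From `c x = x (1 + y x)`. When `1 + y x` is invertible, this determines `y (-c⁻¹ x)` from `y x`
alone. -/
theorem comp_neg_inv_comp_apply {x : E →ₗ[F] V} {y : V →ₗ[F] E} {c : (Module.End F V)ˣ}
    (hc : (c : Module.End F V) = 1 + x ∘ₗ y) (w : E) :
    (y ∘ₗ (-((c⁻¹ : (Module.End F V)ˣ).1 ∘ₗ x))) ((1 + y ∘ₗ x : Module.End F E) w) =
      - (y ∘ₗ x) w := by
  have h1 : x ((1 + y ∘ₗ x : Module.End F E) w) = (c : Module.End F V) (x w) := by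
    rw [hc]; simp
  have h2 : (c⁻¹ : (Module.End F V)ˣ).1 ((c : Module.End F V) (x w)) = x w := by
    rw [← Module.End.mul_apply, c.inv_mul, Module.End.one_apply]
  rw [LinearMap.comp_apply, LinearMap.neg_apply, LinearMap.comp_apply, h1, h2]
  simp

/-- Whether `1 + x y` is a unit whose inverse has modified type `μ` only depends on `ker x`, `range y`
and `y x`. -/
theorem exists_unit_core_inv [Module.Finite F E] [Module.Finite F V'] {x : E →ₗ[F] V}
    {y : V →ₗ[F] E} {x' : E →ₗ[F] V'} {y' : V' →ₗ[F] E}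
    (hx : LinearMap.ker x = LinearMap.ker x') (hy : LinearMap.range y = LinearMap.range y')
    (hyx : y ∘ₗ x = y' ∘ₗ x') (c : (Module.End F V)ˣ)
    (hc : (c : Module.End F V) = 1 + x ∘ₗ y) {μ : Multipartition F}
    (hμ : TypeOf (core (c⁻¹ : (Module.End F V)ˣ).1) μ) :
    ∃ c' : (Module.End F V')ˣ, (c' : Module.End F V') = 1 + x' ∘ₗ y' ∧
      TypeOf (core (c'⁻¹ : (Module.End F V')ˣ).1) μ := by
  have hS : Function.Injective (1 + y ∘ₗ x : Module.End F E) :=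
    injective_of_injective_swap (hc ▸ units_injective c)
  have hc' : IsUnit (1 + x' ∘ₗ y' : Module.End F V') := by
    rw [LinearMap.isUnit_iff_ker_eq_bot, LinearMap.ker_eq_bot]
    rw [hyx] at hS
    exact injective_of_injective_swap hS
  obtain ⟨c', hc'⟩ := hc'
  refine ⟨c', hc', ?_⟩
  -- Here `c⁻¹ - 1 = (-c⁻¹ x) y`, and `-c⁻¹ x` has the same kernel as `x`.
  obtain ⟨e, he⟩ := exists_core_equiv (P := -((c⁻¹ : (Module.End F V)ˣ).1 ∘ₗ x)) (Q := y)
    (P' := -((c'⁻¹ : (Module.End F V')ˣ).1 ∘ₗ x')) (Q' := y')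
    ((ker_neg_units_comp x c⁻¹).trans (hx.trans (ker_neg_units_comp x' c'⁻¹).symm)) hy (by
      ext w
      obtain ⟨u, rfl⟩ := (LinearMap.injective_iff_surjective.1 hS) w
      rw [comp_neg_inv_comp_apply hc, hyx, comp_neg_inv_comp_apply hc'])
    (inv_sub_one_eq hc) (inv_sub_one_eq hc')
  exact hμ.congr e he

end Factorizations

/-! ### Counting factorizations of a stabilized endomorphism -/

section PairCount

variable {F : Type*} [Field F]

/-- The number of factorizations `T = c⁻¹ (c T)` with factors of modified types `μ` and `ν`. -/
noncomputable def pairCount {V : Type*} [AddCommGroup V] [Module F V] (T : Module.End F V)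
    (μ ν : Multipartition F) : ℕ :=
  Nat.card {c : (Module.End F V)ˣ // TypeOf (core (c⁻¹ : (Module.End F V)ˣ).1) μ ∧
    TypeOf (core (c.1 * T)) ν}

theorem TypeOf.core_conj {V V' : Type*} [AddCommGroup V] [Module F V] [AddCommGroup V']
    [Module F V'] {T : Module.End F V} {T' : Module.End F V'} {μ : Multipartition F}
    (h : TypeOf (GLFH.core T) μ) (e : V ≃ₗ[F] V') (he : ∀ v, e (T v) = T' (e v)) :
    TypeOf (GLFH.core T') μ := by
  obtain ⟨e', he'⟩ := exists_core_equiv (P := LinearMap.id) (Q := T - 1)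
    (P' := e.toLinearMap) (Q' := e.symm.toLinearMap ∘ₗ (T' - 1)) (T := T) (T' := T')
    (by simp) (by
      have : e.symm.toLinearMap ∘ₗ (T' - 1) = (T - 1) ∘ₗ e.symm.toLinearMap := by
        ext v
        obtain ⟨v, rfl⟩ := e.surjective v
        simp [← he]
      rw [this, LinearMap.range_comp, LinearEquiv.range, Submodule.map_top])
    (by ext v; simp [← he]) (by ext; simp) (by ext; simp)
  exact h.congr e' he'

theorem pairCount_conj {V V' : Type*} [AddCommGroup V] [Module F V] [AddCommGroup V']
    [Module F V'] {T : Module.End F V} {T' : Module.End F V'}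
    (e : V ≃ₗ[F] V') (he : ∀ v, e (T v) = T' (e v)) (μ ν : Multipartition F) :
    pairCount T μ ν = pairCount T' μ ν := by
  let φ : Module.End F V ≃* Module.End F V' := e.conjRingEquiv.toMulEquiv
  have hφ : ∀ (S : Module.End F V) v, e (S v) = φ S (e v) := fun S v => by
    simp [φ]
  have hφ' : ∀ (S : Module.End F V) v, e.symm (φ S v) = S (e.symm v) := fun S v => by
    rw [LinearEquiv.symm_apply_eq, hφ, LinearEquiv.apply_symm_apply]
  have hT : φ T = T' := by
    ext v
    obtain ⟨v, rfl⟩ := e.surjective v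
    rw [← hφ, he]
  have key : ∀ S : Module.End F V, ∀ μ, TypeOf (core S) μ ↔ TypeOf (core (φ S)) μ := fun S μ =>
    ⟨fun h => h.core_conj e (hφ S), fun h => h.core_conj e.symm (hφ' S)⟩
  refine Nat.card_congr ((Units.mapEquiv φ).toEquiv.subtypeEquiv fun c => ?_)
  rw [key _ μ, key _ ν, map_mul, hT]
  rfl

/-- In this form the kernel visibly depends on `x` only through `ker x`. -/
theorem coprod_inl_add_apply {V₀ E U : Type*} [AddCommGroup V₀] [Module F V₀]
    [AddCommGroup E] [Module F E] [AddCommGroup U] [Module F U]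
    (x₀ : E →ₗ[F] V₀) (y₀ : V₀ →ₗ[F] E) (x : E →ₗ[F] U) (s : E) (t : V₀) :
    ((x₀.prod x).coprod (LinearMap.inl F V₀ U + x₀.prod x ∘ₗ y₀)) (s, t) =
      (x₀ (s + y₀ t) + t, x (s + y₀ t)) := by
  ext
  · simp; abel
  · simp

/-- In this form the range visibly depends on `y` only through `range y`. -/
theorem coprod_prod_eq {V₀ E U : Type*} [AddCommGroup V₀] [Module F V₀]
    [AddCommGroup E] [Module F E] [AddCommGroup U] [Module F U]
    (g : Module.End F V₀) (y₀ : V₀ →ₗ[F] E) (y : U →ₗ[F] E) :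
    (y₀.coprod y).prod (g ∘ₗ LinearMap.fst F V₀ U) =
      (y₀.prod g).coprod (LinearMap.inl F E V₀ ∘ₗ y) := by
  ext <;> simp

/-- For `c = 1 + a b` and `G = g ⊕ 1`, one has `c G - 1 = a b + c (G - 1)`, and `G - 1` factors
through `V₀`. So `c G - 1` factors through `E × V₀`, which does not involve `U`. -/
theorem mul_prodMap_sub_one {V₀ E U : Type*} [AddCommGroup V₀] [Module F V₀]
    [AddCommGroup E] [Module F E] [AddCommGroup U] [Module F U] (g : Module.End F V₀)
    (x₀ : E →ₗ[F] V₀) (y₀ : V₀ →ₗ[F] E) (x : E →ₗ[F] U) (y : U →ₗ[F] E) :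
    (1 + x₀.prod x ∘ₗ y₀.coprod y : Module.End F (V₀ × U)) * g.prodMap 1 - 1 =
      (x₀.prod x).coprod (LinearMap.inl F V₀ U + x₀.prod x ∘ₗ y₀) ∘ₗ
        (y₀.coprod y).prod ((g - 1) ∘ₗ LinearMap.fst F V₀ U) := by
  ext
  · simp; abel
  all_goals simp

/-- Counting the factors `c` of `pairCount` through the factorizations of `c - 1` over a space of
dimension `rank (c - 1)`. -/
theorem card_factorized_pairs [Fintype F] {V : Type*} [AddCommGroup V] [Module F V]
    [Module.Finite F V] (T : Module.End F V) (μ ν : Multipartition F) :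
    Nat.card {p : ((Fin (typeRank μ 1) → F) →ₗ[F] V) × (V →ₗ[F] (Fin (typeRank μ 1) → F)) //
      ∃ c : (Module.End F V)ˣ, c.1 = 1 + p.1 ∘ₗ p.2 ∧
        TypeOf (core (c⁻¹ : (Module.End F V)ˣ).1) μ ∧ TypeOf (core (c.1 * T)) ν} =
    pairCount T μ ν *
      Nat.card ((Fin (typeRank μ 1) → F) ≃ₗ[F] (Fin (typeRank μ 1) → F)) := by
  let E := Fin (typeRank μ 1) → F
  let Y := {p : (E →ₗ[F] V) × (V →ₗ[F] E) //
      ∃ c : (Module.End F V)ˣ, c.1 = 1 + p.1 ∘ₗ p.2 ∧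
        TypeOf (core (c⁻¹ : (Module.End F V)ˣ).1) μ ∧ TypeOf (core (c.1 * T)) ν}
  let X := {c : (Module.End F V)ˣ // TypeOf (core (c⁻¹ : (Module.End F V)ˣ).1) μ ∧
    TypeOf (core (c.1 * T)) ν}
  have : Finite V := Module.finite_of_finite F
  have : Finite (Module.End F V)ˣ := Finite.of_injective Units.val Units.val_injective
  have := Fintype.ofFinite X
  let f : Y → X := fun p => ⟨p.2.choose, p.2.choose_spec.2⟩
  have hf : ∀ p : Y, (f p).1.1 = 1 + p.1.1 ∘ₗ p.1.2 := fun p => p.2.choose_spec.1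
  have hk : ∀ c : X, Nat.card {p : Y // f p = c} = Nat.card (E ≃ₗ[F] E) := by
    intro c
    -- The condition `μ` is on `c⁻¹`; equality of these ranges transfers the rank to `c - 1`, as
    -- needed for `card_factorizations`.
    have h1 : LinearMap.range (c.1.1 - 1) =
        LinearMap.range ((c.1⁻¹ : (Module.End F V)ˣ).1 - 1) := by
      have h2 : c.1.1 - 1 = -(((c.1⁻¹ : (Module.End F V)ˣ).1 - 1) * c.1.1) := by
        rw [sub_mul, c.1.inv_mul, one_mul, neg_sub]
      have h3 : LinearMap.range c.1.1 = ⊤ :=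
        LinearMap.range_eq_top.2 ((Module.End.isUnit_iff _).1 c.1.isUnit).2
      rw [h2, LinearMap.range_neg, Module.End.mul_eq_comp,
        LinearMap.range_comp_of_range_eq_top _ h3]
    rw [← card_factorizations (E := E) (M := c.1.1 - 1)
      (by rw [h1, c.2.1.finrank, Module.finrank_fin_fun])]
    refine Nat.card_congr
      { toFun := fun p => ⟨p.1.1, by
          rw [← congrArg (fun c : X => c.1.1) p.2, hf, add_sub_cancel_left]⟩
        invFun := fun p => ⟨⟨p.1, c.1, by rw [p.2, add_sub_cancel], c.2⟩,
          Subtype.ext <| Units.ext <| by rw [hf]; simp only [p.2, add_sub_cancel]⟩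
        left_inv := fun _ => rfl
        right_inv := fun _ => rfl }
  rw [Nat.card_congr (Equiv.sigmaFiberEquiv f).symm, Nat.card_sigma,
    Finset.sum_congr rfl fun c _ => hk c, Finset.sum_const, Finset.card_univ, smul_eq_mul,
    ← Nat.card_eq_fintype_card]
  rfl

/-- The conditions defining `pairCount`, for a stabilization of `g`, only depend on invariants of
the factorization of `c - 1` that do not refer to the added space. -/
theorem exists_unit_of_invariants {V₀ E U U' : Type*} [AddCommGroup V₀] [Module F V₀]
    [AddCommGroup E] [Module F E] [AddCommGroup U] [Module F U] [AddCommGroup U'] [Module F U']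
    [Module.Finite F V₀] [Module.Finite F E] [Module.Finite F U']
    (g : Module.End F V₀) {μ ν : Multipartition F}
    {x₀ : E →ₗ[F] V₀} {y₀ : V₀ →ₗ[F] E} {x : E →ₗ[F] U} {y : U →ₗ[F] E} {x' : E →ₗ[F] U'}
    {y' : U' →ₗ[F] E} (hx : LinearMap.ker x = LinearMap.ker x')
    (hy : LinearMap.range y = LinearMap.range y') (hyx : y ∘ₗ x = y' ∘ₗ x')
    (h : ∃ c : (Module.End F (V₀ × U))ˣ, c.1 = 1 + x₀.prod x ∘ₗ y₀.coprod y ∧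
      TypeOf (core (c⁻¹ : (Module.End F (V₀ × U))ˣ).1) μ ∧
      TypeOf (core (c.1 * g.prodMap 1)) ν) :
    ∃ c : (Module.End F (V₀ × U'))ˣ, c.1 = 1 + x₀.prod x' ∘ₗ y₀.coprod y' ∧
      TypeOf (core (c⁻¹ : (Module.End F (V₀ × U'))ˣ).1) μ ∧
      TypeOf (core (c.1 * g.prodMap 1)) ν := by
  obtain ⟨c, hc, hμ, hν⟩ := h
  obtain ⟨c', hc', hμ'⟩ := exists_unit_core_inv (x := x₀.prod x) (y := y₀.coprod y)
    (x' := x₀.prod x') (y' := y₀.coprod y')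
    (by rw [LinearMap.ker_prod, LinearMap.ker_prod, hx])
    (by rw [LinearMap.range_coprod, LinearMap.range_coprod, hy])
    (by rw [LinearMap.coprod_comp_prod, LinearMap.coprod_comp_prod, hyx]) c hc hμ
  refine ⟨c', hc', hμ', ?_⟩
  have hxk : ∀ w, x w = 0 ↔ x' w = 0 := fun w => by
    rw [← LinearMap.mem_ker, hx, LinearMap.mem_ker]
  have hyxw : ∀ w, y (x w) = y' (x' w) := fun w => LinearMap.congr_fun hyx w
  obtain ⟨e, he⟩ := exists_core_equiv (W := E × V₀)
    (P := (x₀.prod x).coprod (LinearMap.inl F V₀ U + x₀.prod x ∘ₗ y₀))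
    (Q := (y₀.coprod y).prod ((g - 1) ∘ₗ LinearMap.fst F V₀ U))
    (P' := (x₀.prod x').coprod (LinearMap.inl F V₀ U' + x₀.prod x' ∘ₗ y₀))
    (Q' := (y₀.coprod y').prod ((g - 1) ∘ₗ LinearMap.fst F V₀ U'))
    (T := c.1 * g.prodMap 1) (T' := c'.1 * g.prodMap 1)
    (by
      ext ⟨s, t⟩
      rw [LinearMap.mem_ker, LinearMap.mem_ker, coprod_inl_add_apply, coprod_inl_add_apply,
        Prod.mk_eq_zero, Prod.mk_eq_zero, hxk])
    (by rw [coprod_prod_eq, coprod_prod_eq, LinearMap.range_coprod, LinearMap.range_coprod,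
        LinearMap.range_comp, LinearMap.range_comp, hy])
    (by ext <;> simp [hyxw])
    (by rw [hc, mul_prodMap_sub_one]) (by rw [hc', mul_prodMap_sub_one])
  exact hν.congr e he

/-- The `V₀`-components of a factorization form the fixed finite parameter set, the components along
`F ^ n` are the pairs `(x, y)`; each `c` is counted `|GL(E)|` times. -/
theorem pairCount_stabilize [Fintype F] {V₀ : Type*} [AddCommGroup V₀] [Module F V₀]
    [Module.Finite F V₀]
    (g : Module.End F V₀) (μ ν : Multipartition F) :
    (fun n : ℕ => (pairCount (g.prodMap (1 : Module.End F (Fin n → F))) μ ν : ℚ)) ∈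
      powPoly F := by
  let E := Fin (typeRank μ 1) → F
  let C : ∀ n : ℕ, (E →ₗ[F] V₀) × (V₀ →ₗ[F] E) → (E →ₗ[F] (Fin n → F)) →
      ((Fin n → F) →ₗ[F] E) → Prop := fun n s x y =>
    ∃ c : (Module.End F (V₀ × (Fin n → F)))ˣ, c.1 = 1 + s.1.prod x ∘ₗ s.2.coprod y ∧
      TypeOf (core (c⁻¹ : (Module.End F (V₀ × (Fin n → F)))ˣ).1) μ ∧
      TypeOf (core (c.1 * g.prodMap 1)) ν
  have hmem := card_invariant_mem_powPoly C fun n n' s x y x' y' hx hy hyx h =>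
    exists_unit_of_invariants g hx hy hyx h
  have : Finite E := Module.finite_of_finite F
  have hE : (Nat.card (E ≃ₗ[F] E) : ℚ) ≠ 0 := by
    have : Finite (E ≃ₗ[F] E) := Finite.of_injective (fun e : E ≃ₗ[F] E => (e : E → E))
      DFunLike.coe_injective
    have : Nonempty (E ≃ₗ[F] E) := ⟨LinearEquiv.refl F E⟩
    exact_mod_cast Nat.card_pos.ne'
  convert mul_mem hmem (const_mem_powPoly (F := F) (Nat.card (E ≃ₗ[F] E) : ℚ)⁻¹) using 1
  funext n
  rw [Pi.mul_apply, eq_mul_inv_iff_mul_eq₀ hE]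
  let V := V₀ × (Fin n → F)
  let e : ((E →ₗ[F] V₀) × (V₀ →ₗ[F] E)) × (E →ₗ[F] (Fin n → F)) × ((Fin n → F) →ₗ[F] E) ≃
      (E →ₗ[F] V) × (V →ₗ[F] E) :=
    (Equiv.prodProdProdComm _ _ _ _).trans
      ((LinearMap.prodEquiv F).toEquiv.prodCongr (LinearMap.coprodEquiv F).toEquiv)
  rw [Nat.card_congr (e.subtypeEquiv fun p => Iff.rfl :
    {p : ((E →ₗ[F] V₀) × (V₀ →ₗ[F] E)) × (E →ₗ[F] (Fin n → F)) × ((Fin n → F) →ₗ[F] E) //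
      C n p.1 p.2.1 p.2.2} ≃ {p : (E →ₗ[F] V) × (V →ₗ[F] E) //
      ∃ c : (Module.End F V)ˣ, c.1 = 1 + p.1 ∘ₗ p.2 ∧
        TypeOf (core (c⁻¹ : (Module.End F V)ˣ).1) μ ∧ TypeOf (core (c.1 * g.prodMap 1)) ν}),
    card_factorized_pairs, Nat.cast_mul]

end PairCount

/-! ### Polynomials with values in `ℤ[q⁻¹]` -/

section IntegerValued

variable {F : Type*} [Fintype F]

theorem inv_q_mem_ZInv : (q F)⁻¹ ∈ ZInv F := Subring.subset_closure rfl

theorem q_mem_ZInv : q F ∈ ZInv F := natCast_mem (ZInv F) _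

theorem evalAt_coe (n : ℤ) (f : Rq F) : (evalAt F n f : ℚ) = (f : ℚ[X]).eval (qInt F n) := rfl

variable [Field F]

/-- A polynomial in `q ^ n` whose values lie in `ℤ[q⁻¹]` for large `n` has values in `ℤ[q⁻¹]` for
all integers `n`. -/
theorem eval_zpow_mem_ZInv (d : ℕ) : ∀ g : ℚ[X], g.degree < d → ∀ m₀ : ℤ,
    (∀ n : ℤ, m₀ ≤ n → g.eval (q F ^ n) ∈ ZInv F) → ∀ n : ℤ, g.eval (q F ^ n) ∈ ZInv F := by
  induction d with
  | zero =>
    intro g hg m₀ _ n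
    rw [Polynomial.degree_lt_iff_coeff_zero] at hg
    rw [show g = 0 from Polynomial.ext fun i => by simpa using hg i (Nat.zero_le i), eval_zero]
    exact zero_mem _
  | succ d ih =>
    intro g hg m₀ h
    -- The `q`-difference `g(q x) - q ^ d g(x)` kills the coefficient of degree `d`.
    let g' := g.comp (C (q F) * X) - C (q F ^ d) * g
    have hg' : g'.degree < d := by
      rw [Polynomial.degree_lt_iff_coeff_zero] at hg ⊢
      intro i hi
      rw [coeff_sub, comp_C_mul_X_coeff, coeff_C_mul]
      rcases hi.eq_or_lt with rfl | hi
      · ring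
      · rw [hg i hi]; ring
    have heval : ∀ n : ℤ, g'.eval (q F ^ n) =
        g.eval (q F ^ (n + 1)) - q F ^ d * g.eval (q F ^ n) := fun n => by
      rw [zpow_add_one₀ (q_ne_zero F), mul_comm (q F ^ n)]
      simp only [g', eval_sub, eval_mul, eval_comp, eval_C, eval_X]
    have h' := ih g' hg' m₀ fun n hn => by
      rw [heval]
      exact sub_mem (h _ (by omega)) (mul_mem (pow_mem q_mem_ZInv _) (h n hn))
    intro n
    rcases le_total m₀ n with hn | hn
    · exact h n hn
    · induction n, hn using Int.leInductionDown with
      | base => exact h m₀ le_rfl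
      | pred n hn hi =>
        have h1 := heval (n - 1)
        rw [sub_add_cancel] at h1
        -- Descending by one step divides by `q ^ d`, which is allowed in `ℤ[q⁻¹]`.
        have h2 : g.eval (q F ^ (n - 1)) =
            (q F)⁻¹ ^ d * (g.eval (q F ^ n) - g'.eval (q F ^ (n - 1))) := by
          rw [h1, sub_sub_cancel, ← mul_assoc, ← mul_pow, inv_mul_cancel₀ (q_ne_zero F), one_pow,
            one_mul]
        rw [h2]
        exact mul_mem (pow_mem inv_q_mem_ZInv _) (sub_mem hi (h' _))

theorem q_sub_one_ne_zero : q F - 1 ≠ 0 := (sub_pos.2 (one_lt_q F)).ne'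

theorem one_add_mul_qInt (n : ℤ) : 1 + (q F - 1) * qInt F n = q F ^ n := by
  rw [qInt, mul_div_cancel₀ _ q_sub_one_ne_zero]; ring

theorem qInt_injective : Function.Injective (qInt F) := fun a b h => by
  have := congrArg (fun x => 1 + (q F - 1) * x) h
  simp only [one_add_mul_qInt] at this
  exact zpow_right_injective₀ (zero_lt_one.trans (one_lt_q F)) (one_lt_q F).ne' this

theorem mem_Rq_of_le {f : ℚ[X]} (m₀ : ℕ)
    (h : ∀ m : ℕ, m₀ ≤ m → f.eval (qInt F m) ∈ ZInv F) : f ∈ Rq F := by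
  let g := f.comp (C (q F - 1)⁻¹ * (X - 1))
  have hg : ∀ n : ℤ, g.eval (q F ^ n) = f.eval (qInt F n) := fun n => by
    simp [g, eval_comp, qInt, div_eq_inv_mul]
  intro n
  rw [← hg]
  refine eval_zpow_mem_ZInv (g.natDegree + 1) g
    (lt_of_le_of_lt degree_le_natDegree (by exact_mod_cast Nat.lt_succ_self _)) m₀ (fun n hn => ?_) n
  lift n to ℕ using (by omega)
  rw [hg]
  exact h n (by exact_mod_cast hn)

theorem Rq_ext_of_le {f g : Rq F} (m₀ : ℕ)
    (h : ∀ m : ℕ, m₀ ≤ m → evalAt F m f = evalAt F m g) : f = g := by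
  refine Subtype.ext (Polynomial.eq_of_infinite_eval_eq _ _ ?_)
  refine Set.Infinite.mono (s := Set.range fun i : ℕ => qInt F ((m₀ + i : ℕ) : ℤ)) ?_
    (Set.infinite_range_of_injective fun a b hab => ?_)
  · rintro _ ⟨i, rfl⟩
    exact congrArg Subtype.val (h (m₀ + i) (Nat.le_add_right _ _))
  · have := qInt_injective hab
    omega

end IntegerValued

/-! ### Structure constants as polynomials in `[m]_q` -/

section StructureCount

variable {F : Type*} [Field F]

theorem core_prodMap_one {V U : Type*} [AddCommGroup V] [Module F V] [AddCommGroup U] [Module F U]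
    {g : Module.End F V} {μ : Multipartition F} (h : TypeOf (core g) μ) :
    TypeOf (core (g.prodMap (1 : Module.End F U))) μ := by
  obtain ⟨e, he⟩ := exists_core_equiv (P := LinearMap.id) (Q := g - 1)
    (P' := LinearMap.inl F V U) (Q' := (g - 1) ∘ₗ LinearMap.fst F V U) (T := g)
    (T' := g.prodMap (1 : Module.End F U))
    (by rw [LinearMap.ker_id, LinearMap.ker_eq_bot.2 LinearMap.inl_injective])
    (LinearMap.range_comp_of_range_eq_top _
      (LinearMap.range_eq_top.2 LinearMap.fst_surjective)).symm
    (by ext; simp) rfl (by ext <;> simp)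
  exact h.congr e he

/-- The number of ways to write `g` as a product of elements of modified types `μ` and `ν`. -/
noncomputable def structureCount {m : ℕ} (g : GL (Fin m) F) (μ ν : Multipartition F) : ℕ :=
  Nat.card {a : GL (Fin m) F // HasModifiedType a μ ∧ HasModifiedType (a⁻¹ * g) ν}

theorem structureCount_eq_pairCount {m : ℕ} (g : GL (Fin m) F) (μ ν : Multipartition F) :
    structureCount g μ ν =
      pairCount (Matrix.toLin' (g : Matrix (Fin m) (Fin m) F)) μ ν := by
  refine Nat.card_congr (Equiv.subtypeEquiv ((Equiv.inv _).trans
    Matrix.GeneralLinearGroup.toLin.toEquiv) fun a => ?_)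
  rw [hasModifiedType_iff, hasModifiedType_iff]
  have h1 : (((Equiv.inv _).trans Matrix.GeneralLinearGroup.toLin.toEquiv) a)⁻¹ =
      Matrix.GeneralLinearGroup.toLin a := by
    change (Matrix.GeneralLinearGroup.toLin a⁻¹)⁻¹ = _
    rw [map_inv, inv_inv]
  have h2 : (((Equiv.inv _).trans Matrix.GeneralLinearGroup.toLin.toEquiv) a).1 *
      Matrix.toLin' (g : Matrix (Fin m) (Fin m) F) =
      (Matrix.GeneralLinearGroup.toLin (a⁻¹ * g)).1 := by
    rw [map_mul]; rfl
  rw [h1, h2]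
  rfl

/-- If `g₀` has modified type `ν`, then all larger general linear groups have elements of modified
type `ν`. -/
theorem exists_hasModifiedType_of_le {m₀ m : ℕ} (hm : m₀ ≤ m) {g₀ : GL (Fin m₀) F}
    {ν : Multipartition F} (h : HasModifiedType g₀ ν) :
    ∃ (g : GL (Fin m) F) (e : (Fin m → F) ≃ₗ[F] (Fin m₀ → F) × (Fin (m - m₀) → F)),
      HasModifiedType g ν ∧ ∀ v, e (Matrix.toLin' (g : Matrix (Fin m) (Fin m) F) v) =
        (Matrix.toLin' (g₀ : Matrix (Fin m₀) (Fin m₀) F)).prodMap 1 (e v) := by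
  rw [hasModifiedType_iff] at h
  have hc := core_prodMap_one (U := Fin (m - m₀) → F) h
  set T := (Matrix.toLin' (g₀ : Matrix (Fin m₀) (Fin m₀) F)).prodMap
    (1 : Module.End F (Fin (m - m₀) → F))
  let e : (Fin m → F) ≃ₗ[F] (Fin m₀ → F) × (Fin (m - m₀) → F) := LinearEquiv.ofFinrankEq _ _ (by
    rw [Module.finrank_prod]; simp only [Module.finrank_fin_fun]; omega)
  have hT : Function.Injective T := injective_of_core_injective hc.injective
  let T' : Module.End F (Fin m → F) := e.symm.toLinearMap ∘ₗ T ∘ₗ e.toLinearMap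
  have hT' : Function.Injective T' := e.symm.injective.comp (hT.comp e.injective)
  let g : GL (Fin m) F := Matrix.GeneralLinearGroup.toLin.symm
    (LinearMap.GeneralLinearGroup.ofLinearEquiv (LinearEquiv.ofInjectiveEndo T' hT'))
  have hg : Matrix.toLin' (g : Matrix (Fin m) (Fin m) F) = T' := by
    have : Matrix.GeneralLinearGroup.toLin g = LinearMap.GeneralLinearGroup.ofLinearEquiv
        (LinearEquiv.ofInjectiveEndo T' hT') := MulEquiv.apply_symm_apply _ _
    exact congrArg Units.val this
  refine ⟨g, e, ?_, ?_⟩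
  · rw [hasModifiedType_iff, hg]
    exact hc.core_conj e.symm fun v => by simp [T']
  · intro v
    rw [hg]
    simp [T']

theorem exists_hasModifiedType (ν : Multipartition F) :
    ∃ (m : ℕ) (g : GL (Fin m) F), HasModifiedType g ν := by
  obtain ⟨μ, rfl⟩ := exists_modify_eq ν
  obtain ⟨g, hg⟩ := exists_hasType μ
  exact ⟨_, g, μ, hg, rfl⟩

theorem HasModifiedType.unique {m : ℕ} {g : GL (Fin m) F} {μ ν : Multipartition F}
    (h : HasModifiedType g μ) (h' : HasModifiedType g ν) : μ = ν := by
  rw [hasModifiedType_iff] at h h'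
  exact h.unique h'

theorem exists_modifiedType {m : ℕ} (g : GL (Fin m) F) :
    ∃ ν, HasModifiedType g ν := by
  obtain ⟨μ, hμ⟩ := exists_typeOf
    (units_injective (Matrix.GeneralLinearGroup.toLin g))
  exact ⟨_, μ, hμ, rfl⟩

theorem HasModifiedType.finrank {m : ℕ} {g : GL (Fin m) F} {ν : Multipartition F}
    (h : HasModifiedType g ν) : Module.finrank F
      (LinearMap.range (Matrix.toLin' (g : Matrix (Fin m) (Fin m) F) - 1)) = typeRank ν 1 :=
  ((hasModifiedType_iff g ν).1 h).finrank

/-- From `A B - 1 = (A - 1) B + (B - 1)`, the rank of `g - 1` is subadditive. This bounds the `λ`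
that can occur in a product. -/
theorem typeRank_le_of_structureCount_ne_zero {m : ℕ} {g : GL (Fin m) F}
    {μ ν l : Multipartition F} (hg : HasModifiedType g l) (h : structureCount g μ ν ≠ 0) :
    typeRank l 1 ≤ typeRank μ 1 + typeRank ν 1 := by
  obtain ⟨⟨a, ha, hb⟩⟩ := (Nat.card_ne_zero.1 h).1
  rw [← hg.finrank, ← ha.finrank, ← hb.finrank]
  set A := Matrix.toLin' (a : Matrix (Fin m) (Fin m) F)
  set B := Matrix.toLin' ((a⁻¹ * g : GL (Fin m) F) : Matrix (Fin m) (Fin m) F)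
  have hAB : Matrix.toLin' (g : Matrix (Fin m) (Fin m) F) = A ∘ₗ B := by
    rw [← Matrix.toLin'_mul, ← Units.val_mul, mul_inv_cancel_left]
  have hle : LinearMap.range (Matrix.toLin' (g : Matrix (Fin m) (Fin m) F) - 1) ≤
      LinearMap.range (A - 1) ⊔ LinearMap.range (B - 1) := by
    rintro _ ⟨v, rfl⟩
    rw [hAB, show ((A ∘ₗ B - 1 : Module.End F (Fin m → F))) v = (A - 1) (B v) + (B - 1) v by simp]
    exact Submodule.add_mem_sup ⟨_, rfl⟩ ⟨_, rfl⟩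
  exact (Submodule.finrank_mono hle).trans (Submodule.finrank_add_le_finrank_add_finrank _ _)

variable [Fintype F]

theorem exists_structure_polynomial (μ ν l : Multipartition F) :
    ∃ f : Rq F, ∀ (m : ℕ) (g : GL (Fin m) F), HasModifiedType g l →
      (evalAt F m f : ℚ) = structureCount g μ ν := by
  classical
  -- Minimality of `m₀` ensures that every `g` of modified type `l`, in any `GL_m`, has `m ≥ m₀` and
  -- so is conjugate to `g₀ ⊕ 1`.
  let m₀ := Nat.find (exists_hasModifiedType l)
  obtain ⟨g₀, hg₀⟩ : ∃ g : GL (Fin m₀) F, HasModifiedType g l :=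
    Nat.find_spec (exists_hasModifiedType l)
  obtain ⟨P, hP⟩ := exists_eval_of_mem_powPoly
    (pairCount_stabilize (Matrix.toLin' (g₀ : Matrix (Fin m₀) (Fin m₀) F)) μ ν)
  -- The substitution sends `[m]_q` to `q ^ (m - m₀)`.
  let f := P.comp (C (q F ^ m₀)⁻¹ * (1 + C (q F - 1) * X))
  have hf : ∀ m : ℕ, m₀ ≤ m → f.eval (qInt F m) =
      pairCount ((Matrix.toLin' (g₀ : Matrix (Fin m₀) (Fin m₀) F)).prodMap
        (1 : Module.End F (Fin (m - m₀) → F))) μ ν := by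
    intro m hm
    rw [hP]
    have : (q F ^ m₀)⁻¹ * (1 + (q F - 1) * qInt F m) = q F ^ (m - m₀) := by
      rw [one_add_mul_qInt, zpow_natCast, pow_sub₀ _ (q_ne_zero F) hm, mul_comm]
    simp only [f, eval_comp, eval_mul, eval_C, eval_add, eval_one, eval_X, this]
  refine ⟨⟨f, mem_Rq_of_le m₀ fun m hm => by rw [hf m hm]; exact natCast_mem _ _⟩, ?_⟩
  intro m g hg
  have hm : m₀ ≤ m := Nat.find_min' _ ⟨g, hg⟩
  rw [evalAt_coe, hf m hm, structureCount_eq_pairCount]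
  rw [hasModifiedType_iff] at hg hg₀
  obtain ⟨e, he⟩ := exists_equiv_of_core hg (core_prodMap_one (U := Fin (m - m₀) → F) hg₀) (by
    rw [Module.finrank_prod]; simp only [Module.finrank_fin_fun]; omega)
  rw [pairCount_conj e he]

/-- Each such `μ` is the type of a matrix in one of the finite groups `GL_j` with `j ≤ d`, and a
matrix has only one type. -/
theorem finite_setOf_typeRank_le (d : ℕ) : {μ : Multipartition F | typeRank μ 1 ≤ d}.Finite := by
  let φ : {μ : Multipartition F | typeRank μ 1 ≤ d} → Σ j : Fin (d + 1), GL (Fin j) F := fun μ =>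
    ⟨⟨typeRank μ.1 1, Nat.lt_succ_of_le μ.2⟩, (exists_hasType μ.1).choose⟩
  have hφ : ∀ μ, HasType (φ μ).2 μ.1 := fun μ => (exists_hasType μ.1).choose_spec
  have : Finite {μ : Multipartition F | typeRank μ 1 ≤ d} :=
    Finite.of_injective φ fun μ ν h => Subtype.ext <| by
      have h1 := hφ μ
      rw [h] at h1
      exact TypeOf.unique h1 (hφ ν)
  exact Set.toFinite _

end StructureCount

/-! ### Class sums, and existence and uniqueness of the structure constants -/

section ClassSums

variable {F : Type*} [Field F]

theorem HasModifiedType.conj {n : ℕ} {g : GL (Fin n) F} {ν : Multipartition F}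
    (h : HasModifiedType g ν) (a : GL (Fin n) F) : HasModifiedType (a * g * a⁻¹) ν := by
  rw [hasModifiedType_iff] at h ⊢
  refine h.core_conj (LinearMap.GeneralLinearGroup.toLinearEquiv
    (Matrix.GeneralLinearGroup.toLin a)) fun v => ?_
  change Matrix.toLin' a.1 (Matrix.toLin' g.1 v) =
    Matrix.toLin' (a * g * a⁻¹ : GL (Fin n) F).1 (Matrix.toLin' a.1 v)
  rw [← LinearMap.comp_apply, ← LinearMap.comp_apply, ← Matrix.toLin'_mul, ← Matrix.toLin'_mul,
    ← Units.val_mul, ← Units.val_mul, inv_mul_cancel_right]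

theorem hasModifiedType_zero_iff {n : ℕ} (g : GL (Fin n) F) :
    HasModifiedType g (0 : Multipartition F) ↔ g = 1 := by
  have h0 : ∀ f : F[X], typeRank (0 : Multipartition F) f = 0 := fun f => by
    simp [typeRank, parts]
  constructor
  · intro h
    have h1 := h.finrank
    rw [h0, Submodule.finrank_eq_zero, LinearMap.range_eq_bot, sub_eq_zero] at h1
    refine Units.ext (Matrix.toLin'.injective (h1.trans ?_))
    exact Matrix.toLin'_one.symm
  · rintro rfl
    obtain ⟨ν, hν⟩ := exists_modifiedType (1 : GL (Fin n) F)
    convert hν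
    refine eq_of_typeRank_eq fun f hf => ?_
    have h1 : LinearMap.range
        (Matrix.toLin' ((1 : GL (Fin n) F) : Matrix (Fin n) (Fin n) F) - 1) = ⊥ := by
      rw [LinearMap.range_eq_bot, sub_eq_zero]
      exact Matrix.toLin'_one
    have h2 := (Submodule.finrank_le (LinearMap.range (aeval (core (Matrix.toLin'
      ((1 : GL (Fin n) F) : Matrix (Fin n) (Fin n) F))) f)))
    rw [((hasModifiedType_iff _ _).1 hν).finrank_range hf, h1, finrank_bot] at h2
    rw [h0]
    omega

variable [Fintype F]

variable (F) in
/-- The group algebra `ℤ[q⁻¹] GL_n(F)`. -/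
abbrev GroupAlg (n : ℕ) : Type _ := MonoidAlgebra (ZInv F) (GL (Fin n) F)

open Classical in
theorem extendScalars_classSum (n : ℕ) (ν : Multipartition F) :
    extendScalars F n (classSum n ν) =
      ∑ g : GL (Fin n) F with HasModifiedType g ν, MonoidAlgebra.single g 1 := by
  simp [extendScalars, classSum]

open Classical in
theorem coeff_extendScalars_classSum {n : ℕ} (ν : Multipartition F) (g : GL (Fin n) F) :
    (extendScalars F n (classSum n ν)).coeff g = if HasModifiedType g ν then 1 else 0 := by
  rw [extendScalars_classSum, MonoidAlgebra.coeff_sum, Finsupp.finsetSum_apply]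
  simp [Finsupp.single_apply]

theorem coeff_classSum_of_hasModifiedType {n : ℕ} {l : Multipartition F} {g : GL (Fin n) F}
    (hg : HasModifiedType g l) (ν : Multipartition F) [Decidable (ν = l)] :
    (extendScalars F n (classSum n ν)).coeff g = if ν = l then 1 else 0 := by
  classical
  rw [coeff_extendScalars_classSum]
  exact if_congr ⟨fun h => h.unique hg, fun h => h ▸ hg⟩ rfl rfl

theorem coeff_classSum_mul {n : ℕ} (μ ν : Multipartition F) (g : GL (Fin n) F) :
    (extendScalars F n (classSum n μ * classSum n ν)).coeff g = structureCount g μ ν := by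
  classical
  rw [map_mul, extendScalars_classSum, extendScalars_classSum, Finset.sum_mul_sum,
    MonoidAlgebra.coeff_sum, Finsupp.finsetSum_apply]
  simp only [MonoidAlgebra.coeff_sum, Finsupp.finsetSum_apply, MonoidAlgebra.single_mul_single,
    MonoidAlgebra.coeff_single, Finsupp.single_apply, mul_one]
  have : ∀ a b : GL (Fin n) F, a * b = g ↔ a⁻¹ * g = b := fun a b => by
    rw [inv_mul_eq_iff_eq_mul, eq_comm]
  simp only [this, Finset.sum_ite_eq, Finset.mem_filter, Finset.mem_univ, true_and]
  rw [Finset.sum_boole, Finset.filter_filter, structureCount, Nat.card_eq_fintype_card,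
    Fintype.card_subtype]

theorem classSum_mem_center (n : ℕ) (ν : Multipartition F) :
    extendScalars F n (classSum n ν) ∈ Subalgebra.center (ZInv F) (GroupAlg F n) := by
  classical
  rw [Subalgebra.mem_center_iff]
  intro b
  induction b using MonoidAlgebra.induction_linear with
  | zero => simp
  | add x y hx hy => rw [add_mul, mul_add, hx, hy]
  | single h c =>
    rw [extendScalars_classSum, Finset.mul_sum, Finset.sum_mul]
    simp only [MonoidAlgebra.single_mul_single, mul_one, one_mul]
    refine Finset.sum_bij' (fun a _ => h * a * h⁻¹) (fun a _ => h⁻¹ * a * h) ?_ ?_ ?_ ?_ ?_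
    · intro a ha
      simp only [Finset.mem_filter, Finset.mem_univ, true_and] at ha ⊢
      exact ha.conj h
    · intro a ha
      simp only [Finset.mem_filter, Finset.mem_univ, true_and] at ha ⊢
      simpa using ha.conj h⁻¹
    · intro a _; group
    · intro a _; group
    · intro a _; rw [inv_mul_cancel_right]

theorem extendScalars_classSum_zero (n : ℕ) :
    extendScalars F n (classSum n (0 : Multipartition F)) = 1 := by
  classical
  rw [extendScalars_classSum]
  simp only [hasModifiedType_zero_iff]
  rw [Finset.sum_filter, Finset.sum_ite_eq']
  simp [MonoidAlgebra.one_def]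

/-- Every `g` has exactly one modified type, so comparing coefficients at `g` leaves a single term
of the sum. -/
theorem interpolates_iff (r : StructureConstants F) :
    Interpolates r ↔ ∀ (m : ℕ) (μ ν l : Multipartition F) (g : GL (Fin m) F),
      HasModifiedType g l → (evalAt F m (r μ ν l) : ZInv F) = structureCount g μ ν := by
  classical
  have key : ∀ (m : ℕ) (μ ν l : Multipartition F) (g : GL (Fin m) F), HasModifiedType g l →
      ((r μ ν).sum fun l c => evalAt F m c • extendScalars F m (classSum m l)).coeff g =
        evalAt F m (r μ ν l) := by
    intro m μ ν l g hg
    rw [MonoidAlgebra.coeff_finsuppSum, Finsupp.sum, Finsupp.finsetSum_apply]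
    simp only [MonoidAlgebra.coeff_smul, Finsupp.smul_apply,
      coeff_classSum_of_hasModifiedType hg, smul_eq_mul, mul_ite, mul_one, mul_zero]
    rw [Finset.sum_ite_eq']
    split_ifs with h
    · rfl
    · rw [Finsupp.notMem_support_iff.1 h, map_zero]
  constructor
  · intro h m μ ν l g hg
    rw [← coeff_classSum_mul, h m μ ν, key m μ ν l g hg]
  · intro h m μ ν
    refine MonoidAlgebra.ext (Finsupp.ext fun g => ?_)
    obtain ⟨l, hg⟩ := exists_modifiedType g
    rw [coeff_classSum_mul, key m μ ν l g hg, h m μ ν l g hg]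

theorem Rq_ext_of_hasModifiedType {f f' : Rq F} (l : Multipartition F)
    (h : ∀ (m : ℕ) (g : GL (Fin m) F), HasModifiedType g l → evalAt F m f = evalAt F m f') :
    f = f' := by
  obtain ⟨m₀, g₀, hg₀⟩ := exists_hasModifiedType l
  refine Rq_ext_of_le m₀ fun m hm => ?_
  obtain ⟨g, -, hg, -⟩ := exists_hasModifiedType_of_le hm hg₀
  exact h m g hg

theorem existsUnique_interpolates : ∃! r : StructureConstants F, Interpolates r := by
  choose f hf using exists_structure_polynomial (F := F)
  -- Beyond the rank bound all structure counts vanish, so the polynomial vanishes at infinitely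
  -- many `[m]_q`.
  have hsupp : ∀ μ ν l, f μ ν l ≠ 0 →
      l ∈ (finite_setOf_typeRank_le (F := F) (typeRank μ 1 + typeRank ν 1)).toFinset := by
    intro μ ν l hne
    rw [Set.Finite.mem_toFinset]
    by_contra hl
    refine hne (Rq_ext_of_hasModifiedType l fun m g hg => ?_)
    have h0 : structureCount g μ ν = 0 := by
      by_contra h
      exact hl (typeRank_le_of_structureCount_ne_zero hg h)
    refine Subtype.ext ?_
    rw [hf μ ν l m g hg, h0, map_zero]
    simp
  refine ⟨fun μ ν => Finsupp.onFinset _ (f μ ν) (hsupp μ ν), ?_, ?_⟩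
  · refine (interpolates_iff _).2 ?_
    intro m μ ν l g hg
    exact Subtype.ext ((hf μ ν l m g hg).trans (by simp))
  · intro r hr
    rw [interpolates_iff] at hr
    funext μ ν
    ext1 l
    refine Rq_ext_of_hasModifiedType l fun m g hg => ?_
    rw [hr m μ ν l g hg]
    exact Subtype.ext ((hf μ ν l m g hg).trans (by simp)).symm

end ClassSums

/-! ### Specialisation of the Farahat–Higman algebra to group algebras -/

namespace FH

variable {F : Type*} [Field F] [Fintype F] {r : StructureConstants F}

theorem single_eq_smul_K (l : Multipartition F) (c : Rq F) :
    (Finsupp.single l c : Multipartition F →₀ Rq F) = (c • K r l : FH r) := by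
  change _ = c • (Finsupp.single l 1 : Multipartition F →₀ Rq F)
  rw [Finsupp.smul_single, smul_eq_mul, mul_one]

theorem induction_on {P : FH r → Prop} (x : FH r) (zero : P 0) (add : ∀ x y, P x → P y → P (x + y))
    (smul_K : ∀ (c : Rq F) l, P (c • K r l)) : P x :=
  Finsupp.induction_linear (motive := P) x zero add fun l c => by
    rw [single_eq_smul_K (r := r)]; exact smul_K c l

theorem K_mul_K (μ ν : Multipartition F) :
    K r μ * K r ν = (r μ ν).sum fun l c => c • K r l := by
  change mulHom r (K r μ) (K r ν) = _
  rw [mulHom, Module.Basis.constr_basis, Module.Basis.constr_basis]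

variable (r) in
/-- The specialisation `K_μ ↦ X_{μ, n}`, as an additive map to the group algebra. -/
noncomputable def specialize (n : ℕ) : FH r →+ GroupAlg F n :=
  (Finsupp.liftAddHom fun l => ((smulAddHom (ZInv F) (GroupAlg F n)).flip
    (extendScalars F n (classSum n l))).comp (evalAt F n).toAddMonoidHom :
    (Multipartition F →₀ Rq F) →+ GroupAlg F n)

theorem specialize_smul_K (n : ℕ) (c : Rq F) (l : Multipartition F) :
    specialize r n (c • K r l) = evalAt F n c • extendScalars F n (classSum n l) := by
  rw [← single_eq_smul_K]
  exact Finsupp.liftAddHom_apply_single _ _ _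

theorem specialize_K (n : ℕ) (l : Multipartition F) :
    specialize r n (K r l) = extendScalars F n (classSum n l) := by
  rw [← one_smul (Rq F) (K r l), specialize_smul_K, map_one, one_smul]

theorem specialize_smul (n : ℕ) (c : Rq F) (x : FH r) :
    specialize r n (c • x) = evalAt F n c • specialize r n x := by
  induction x using induction_on with
  | zero => simp
  | add x y hx hy => rw [smul_add, map_add, map_add, hx, hy, smul_add]
  | smul_K d l => rw [smul_smul, specialize_smul_K, specialize_smul_K, map_mul, mul_smul]

theorem specialize_mem_center (n : ℕ) (x : FH r) :
    specialize r n x ∈ Subalgebra.center (ZInv F) (GroupAlg F n) := by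
  induction x using induction_on with
  | zero => rw [map_zero]; exact zero_mem _
  | add x y hx hy => rw [map_add]; exact add_mem hx hy
  | smul_K d l =>
    rw [specialize_smul_K]
    exact Subalgebra.smul_mem _ (classSum_mem_center n l) _

theorem specialize_mul (hr : Interpolates r) (n : ℕ) (x y : FH r) :
    specialize r n (x * y) = specialize r n x * specialize r n y := by
  induction x using induction_on with
  | zero => simp
  | add x x' hx hx' => rw [add_mul, map_add, map_add, hx, hx', add_mul]
  | smul_K c μ =>
    rw [smul_mul_assoc, specialize_smul, specialize_smul, smul_mul_assoc]
    congr 1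
    induction y using induction_on with
    | zero => simp
    | add y y' hy hy' => rw [mul_add, map_add, map_add, hy, hy', mul_add]
    | smul_K d ν =>
      rw [mul_smul_comm, specialize_smul, specialize_smul, mul_smul_comm]
      congr 1
      rw [K_mul_K, specialize_K, specialize_K, ← map_mul, hr n μ ν, Finsupp.sum, map_sum]
      exact Finset.sum_congr rfl fun l _ => specialize_smul_K n _ l

/-- The coordinates of `x` are thus visible in its specialisations, which gives joint injectivity.
-/
theorem coeff_specialize {n : ℕ} {l : Multipartition F} {g : GL (Fin n) F}
    (hg : HasModifiedType g l) (x : FH r) :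
    (specialize r n x).coeff g = evalAt F n ((K r).repr x l) := by
  classical
  induction x using induction_on with
  | zero => simp
  | add x y hx hy =>
    rw [map_add, MonoidAlgebra.coeff_add, Finsupp.add_apply, hx, hy, map_add, Finsupp.add_apply,
      map_add]
  | smul_K c k =>
    rw [specialize_smul_K, MonoidAlgebra.coeff_smul, Finsupp.smul_apply,
      coeff_classSum_of_hasModifiedType hg, map_smul, Module.Basis.repr_self, Finsupp.smul_apply,
      Finsupp.single_apply]
    split_ifs <;> simp

/-- The specialisations are jointly injective. -/
theorem ext_specialize {x y : FH r} (h : ∀ n, specialize r n x = specialize r n y) : x = y := by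
  refine (K r).repr.injective (Finsupp.ext fun l => ?_)
  refine Rq_ext_of_hasModifiedType l fun m g hg => ?_
  rw [← coeff_specialize hg, ← coeff_specialize hg, h]

theorem existsUnique_specialization (hr : Interpolates r) (n : ℕ) :
    ∃! Θ : FH r →ₙ+* Subalgebra.center (ZInv F) (GroupAlg F n),
      (∀ μ : Multipartition F, (Θ (K r μ) : GroupAlg F n) = extendScalars F n (classSum n μ)) ∧
      (∀ (c : Rq F) (x : FH r), Θ (c • x) = evalAt F n c • Θ x) ∧ Θ (K r 0) = 1 := by
  refine ⟨{ toFun := fun x => ⟨specialize r n x, specialize_mem_center n x⟩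
            map_mul' := fun x y => Subtype.ext (specialize_mul hr n x y)
            map_zero' := Subtype.ext (map_zero _)
            map_add' := fun x y => Subtype.ext (map_add _ x y) },
    ⟨fun μ => specialize_K n μ, fun c x => Subtype.ext (specialize_smul n c x),
      Subtype.ext ((specialize_K n 0).trans (extendScalars_classSum_zero n))⟩, ?_⟩
  rintro Θ ⟨h1, h2, -⟩
  ext1 x
  refine Subtype.ext ?_
  change (Θ x : GroupAlg F n) = specialize r n x
  induction x using induction_on with
  | zero => rw [map_zero, map_zero]; rfl
  | add x y hx hy => rw [map_add, map_add, ← hx, ← hy]; rfl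
  | smul_K c l => rw [h2, specialize_smul_K, ← h1]; rfl

end FH

end GLFH

/-! ### The main theorem, with ring identities pulled back along the specialisations -/

theorem proposition6p4 {F : Type*} [Field F] [Fintype F] :
    -- The structure constants exist and are unique.
    (∃! r : GLFH.StructureConstants F, GLFH.Interpolates r) ∧
    -- The algebra with these structure constants has the asserted properties.
    ∀ r : GLFH.StructureConstants F, GLFH.Interpolates r →
      (∀ μ ν : GLFH.Multipartition F,
        GLFH.FH.K r μ * GLFH.FH.K r ν = (r μ ν).sum fun l c => c • GLFH.FH.K r l) ∧
      (∀ (c : GLFH.Rq F) (x y : GLFH.FH r),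
        (c • x) * y = c • (x * y) ∧ x * (c • y) = c • (x * y)) ∧
      (∀ x y z : GLFH.FH r, (x * y) * z = x * (y * z)) ∧
      (∀ x y : GLFH.FH r, x * y = y * x) ∧
      (∀ x : GLFH.FH r, GLFH.FH.K r 0 * x = x ∧ x * GLFH.FH.K r 0 = x) ∧
      -- The specialisation homomorphisms.
      (∀ n : ℕ, ∃! Θ : GLFH.FH r →ₙ+*
          Subalgebra.center (GLFH.ZInv F) (MonoidAlgebra (GLFH.ZInv F) (GL (Fin n) F)),
        (∀ μ : GLFH.Multipartition F,
          (Θ (GLFH.FH.K r μ) : MonoidAlgebra (GLFH.ZInv F) (GL (Fin n) F)) =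
            GLFH.extendScalars F n (GLFH.classSum n μ)) ∧
        (∀ (c : GLFH.Rq F) (x : GLFH.FH r), Θ (c • x) = GLFH.evalAt F n c • Θ x) ∧
        Θ (GLFH.FH.K r 0) = 1) := by
  refine ⟨GLFH.existsUnique_interpolates, fun r hr => ⟨GLFH.FH.K_mul_K,
    fun c x y => ⟨smul_mul_assoc c x y, mul_smul_comm c x y⟩, fun x y z => ?_, fun x y => ?_,
    fun x => ⟨?_, ?_⟩, GLFH.FH.existsUnique_specialization hr⟩⟩
  · refine GLFH.FH.ext_specialize fun n => ?_
    simp only [GLFH.FH.specialize_mul hr, mul_assoc]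
  · refine GLFH.FH.ext_specialize fun n => ?_
    rw [GLFH.FH.specialize_mul hr, GLFH.FH.specialize_mul hr]
    exact Subalgebra.mem_center_iff.1 (GLFH.FH.specialize_mem_center n y) _
  · refine GLFH.FH.ext_specialize fun n => ?_
    rw [GLFH.FH.specialize_mul hr, GLFH.FH.specialize_K, GLFH.extendScalars_classSum_zero, one_mul]
  · refine GLFH.FH.ext_specialize fun n => ?_
    rw [GLFH.FH.specialize_mul hr, GLFH.FH.specialize_K, GLFH.extendScalars_classSum_zero, mul_one]
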